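/- **Model.** Consider a radial network: a finite rooted tree with nodes $0,1,\dots,I$, root (feeder) $0$, edges $\epsilon_{pk}$ ($p$ the parent of $k$) with resistance $R_{pk}\ge 0$ and reactance $X_{pk}\ge 0$, not both zero, and EV types $j=1,\dots,J$. Given are the feeder voltage $V_0$, voltage limits $0<\underline\upsilon_k<V_0^2\le\overline\upsilon_k$, numbers of parking spaces $K_i>0$, load limits $M_i>0$, maximal charging rates $c_j^{\max}>0$, arrival rates $\lambda_{ij}>0$, and random vectors $(B_j,D_j)$ (charging requirement, parking time) with $B_j,D_j>0$ a.s. and $\mathbb E D_j<\infty$. The utilities $u_{ij}:[0,\infty)\to[-\infty,\infty)$ are finite on $(0,\infty)$, strictly increasing and strictly concave on $[0,\infty)$, twice differentiable on $(0,\infty)$, with $u_{ij}'(0+)=\infty$. For $\Lambda\in\mathbb R_+^{I\times J}$ and real variables $W_{ii}$ ($0\le i\le I$), $W_{pk}=W_{kp}$ ($\epsilon_{pk}$ an edge) put $\mathbf W(\epsilon_{pk})=\begin{pmatrix}W_{pp}&W_{pk}\\W_{pk}&W_{kk}\end{pmatrix}$, $L_{ls}=(W_{ll}-2W_{ls}+W_{ss})/(R_{ls}^2+X_{ls}^2)$,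 and, with $\mathcal N(k),\mathcal E(k)$ the nodes and edges of the subtree rooted at $k$, $$P_{\mathcal N(k)}=\sum_{l\in\mathcal N(k)}\sum_j\Lambda_{lj}+\sum_{\epsilon_{ls}\in\mathcal E(k)}R_{ls}L_{ls},\qquad Q_{\mathcal N(k)}=\sum_{\epsilon_{ls}\in\mathcal E(k)}X_{ls}L_{ls}.$$ The *relaxed voltage constraints* on $(\Lambda,\mathbf W)$ are: $W_{00}=V_0^2$ and, for every edge $\epsilon_{pk}$, $W_{pk}-W_{kk}-P_{\mathcal N(k)}R_{pk}-Q_{\mathcal N(k)}X_{pk}=0$, $\underline\upsilon_k\le W_{kk}\le\overline\upsilon_k$, and $\mathbf W(\epsilon_{pk})\succeq0$. For $z\in\mathbb R_+^{I\times J}$ the charging rates $p(z)=(p_{ij}(z))$ maximize $\sum_{i,j}z_{ij}u_{ij}(p_{ij})$ over $(p,\mathbf W)$ subject to $\sum_jz_{ij}p_{ij}\le M_i$, $0\le p_{ij}\le c_j^{\max}$, the relaxed voltage constraints with $\Lambda_{ij}=z_{ij}p_{ij}$, and $\operatorname{rank}\mathbf W(\epsilon_{pk})=1$ for all edges; $p_{ij}(z)=0$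 where $z_{ij}=0$. A continuous $z:[0,\infty)\to\mathbb R_+^{I\times J}$ is a *fluid-model solution* if, for some $q_{ij}$ with $q_{ij}(0)\ge0$ and some initial random vectors $(B^0_{ij},D^0_{ij})$, for all $i,j\ge1$, $t\ge0$, $$z_{ij}(t)=z_{ij}(0)\,\mathbb P\Big(B^0_{ij}>\int_0^tp_{ij}(z(v))\,dv,\ D^0_{ij}\ge t\Big)+\int_0^t\gamma_{ij}(s)\,\mathbb P\Big(B_j>\int_s^tp_{ij}(z(v))\,dv,\ D_j\ge t-s\Big)ds,$$ $$q_{ij}(t)=q_{ij}(0)\,\mathbb P(D^0_{ij}\ge t)+\int_0^t\gamma_{ij}(s)\,\mathbb P(D_j\ge t-s)\,ds,\qquad \gamma_{ij}(t)=\lambda_{ij}\mathbf 1\Big\{\sum_{j'}q_{ij'}(t)<K_i\Big\}.$$ A vector $z^*$ is an *invariant point* if $z(t)\equiv z^*$ is a fluid-model solution. Put $\lambda_i=\sum_j\lambda_{ij}$, $$\gamma_{ij}=\frac{\lambda_{ij}}{\lambda_i}\min\Big\{\lambda_i,\ K_i\Big(\sum_{j'}\frac{\lambda_{ij'}}{\lambda_i}\mathbb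 E D_{j'}\Big)^{-1}\Big\},\qquad g_{ij}(x)=\gamma_{ij}\,\mathbb E\min\{D_jx,B_j\}.$$ **Theorem.** (i) Every invariant point $z^*$ satisfies, for all $i,j\ge1$ (with $B_j/0=\infty$), $$z^*_{ij}=\gamma_{ij}\,\mathbb E\Big[\min\Big\{D_j,\frac{B_j}{p_{ij}(z^*)}\Big\}\Big].\qquad(*)$$ (ii) Suppose that for every $j$ the leftmost point $\inf(D_j/B_j)$ of the support of $D_j/B_j$ is at most $1/c_j^{\max}$. Let $g_{ij}^{-1}$ denote the inverse of $g_{ij}:[0,c_j^{\max}]\to[0,g_{ij}(c_j^{\max})]$. There are functions $G_{ij}:[0,g_{ij}(c_j^{\max})]\to[-\infty,\infty)$, finite except possibly at $0$ and continuous, with $G_{ij}'=u_{ij}'\circ g_{ij}^{-1}$ on $(0,g_{ij}(c_j^{\max}))$. For any such $G_{ij}$: each $G_{ij}$ is strictly concave; the problem of maximizing $\sum_{i,j}G_{ij}(\Lambda_{ij})$ over $(\Lambda,\mathbf W)$ subject to the relaxed voltage constraints, $\sum_j\Lambda_{ij}\le M_i$ and $0\le\Lambda_{ij}\le g_{ij}(c_j^{\max})$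 has a solution, with a unique $\Lambda$-part $\Lambda^*$; and $(*)$ has a unique solution $z^*\in\mathbb R_+^{I\times J}$, namely $$z^*_{ij}=\frac{\Lambda^*_{ij}}{g_{ij}^{-1}(\Lambda^*_{ij})}.$$ -/

import Mathlib

open MeasureTheory Set Filter Topology

noncomputable section

namespace EVCharging

/-- The primitive data of the model. `N` is the (finite) set of nodes other than the feeder and `T`
the (finite) set of EV types. The set of all nodes is `Option N`, with `none` the feeder (root).
The edge that joins `k : N` to its parent is indexed by `k`. -/
structure Network (N T : Type*) where
  /-- the parent of a node; `none` is the feeder -/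
  parent : N → Option N
  /-- resistance of the edge from `parent k` to `k` -/
  R : N → ℝ
  /-- reactance of the edge from `parent k` to `k` -/
  X : N → ℝ
  /-- voltage at the feeder -/
  V₀ : ℝ
  /-- lower and upper limits on the squared voltage -/
  vlo : N → ℝ
  vhi : N → ℝ
  /-- number of parking spaces -/
  K : N → ℝ
  /-- maximal power that the parking lot at a node can consume -/
  M : N → ℝ
  /-- maximal charging rate -/
  cmax : T → ℝ
  /-- arrival rates -/
  lam : N → T → ℝ
  /-- joint law of (charging requirement, parking time) `(B_j, D_j)` -/
  F : T → Measure (ℝ × ℝ)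
  /-- utility functions; only the values on `[0, ∞)` matter, and the value at `0` may be `-∞`
  (as for the logarithm) -/
  u : N → T → ℝ → EReal

/-- Strict concavity on `s` of an extended-real-valued function. -/
def StrictConcaveOnE (s : Set ℝ) (f : ℝ → EReal) : Prop :=
  ∀ x ∈ s, ∀ y ∈ s, x ≠ y → ∀ a b : ℝ, 0 < a → 0 < b → a + b = 1 →
    (a : EReal) * f x + (b : EReal) * f y < f (a * x + b * y)

/-- Derivative of an extended-real-valued function at a point near which it is finite. -/
def derivE (f : ℝ → EReal) (x : ℝ) : ℝ := deriv (fun y => (f y).toReal) x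

/-- The requirements on a utility function: strictly increasing and strictly concave on `[0, ∞)`,
finite and twice differentiable on `(0, ∞)`, with infinite slope at `0`. -/
structure IsUtility (u : ℝ → EReal) : Prop where
  strictMono : StrictMonoOn u (Ici 0)
  strictConcave : StrictConcaveOnE (Ici 0) u
  finite : ∀ x : ℝ, 0 < x → u x ≠ ⊥ ∧ u x ≠ ⊤
  diff : ∀ x : ℝ, 0 < x → DifferentiableAt ℝ (fun y => (u y).toReal) x
  diff₂ : ∀ x : ℝ, 0 < x → DifferentiableAt ℝ (derivE u) x
  slope : Tendsto (derivE u) (𝓝[>] 0) atTop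

/-- The leftmost point of the support of a distribution on the real line. -/
def leftmost (μ : Measure ℝ) : ℝ := sInf μ.support

namespace Network

variable {N T : Type*}

/-- The standing assumptions of the model. -/
structure Standing (𝒩 : Network N T) : Prop where
  /-- following parents one always ends at the feeder: the graph is a rooted tree -/
  tree : WellFounded (fun a b : N => 𝒩.parent b = some a)
  R_nonneg : ∀ k, 0 ≤ 𝒩.R k
  X_nonneg : ∀ k, 0 ≤ 𝒩.X k
  impedance : ∀ k, 𝒩.R k ≠ 0 ∨ 𝒩.X k ≠ 0
  vlo_pos : ∀ k, 0 < 𝒩.vlo k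
  vlo_lt : ∀ k, 𝒩.vlo k < 𝒩.V₀ ^ 2
  le_vhi : ∀ k, 𝒩.V₀ ^ 2 ≤ 𝒩.vhi k
  K_pos : ∀ i, 0 < 𝒩.K i
  M_pos : ∀ i, 0 < 𝒩.M i
  cmax_pos : ∀ j, 0 < 𝒩.cmax j
  lam_pos : ∀ i j, 0 < 𝒩.lam i j
  prob : ∀ j, IsProbabilityMeasure (𝒩.F j)
  B_pos : ∀ j, ∀ᵐ x ∂𝒩.F j, 0 < x.1
  D_pos : ∀ j, ∀ᵐ x ∂𝒩.F j, 0 < x.2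
  D_integrable : ∀ j, Integrable (fun x : ℝ × ℝ => x.2) (𝒩.F j)
  utility : ∀ i j, IsUtility (𝒩.u i j)

/-- The variables `W_ii` (`diag`) and `W_pk`, `p` the parent of `k` (`off k`). -/
structure WVar (N : Type*) where
  diag : Option N → ℝ
  off : N → ℝ

/-- The symmetric matrix `W(ε_pk)` of the edge from the parent `p` of `k` to `k`. -/
def edgeMatrix (𝒩 : Network N T) (W : WVar N) (k : N) : Matrix (Fin 2) (Fin 2) ℝ :=
  !![W.diag (𝒩.parent k), W.off k; W.off k, W.diag (some k)]

/-- Active power loss on the edge above `s`. -/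
def lossP (𝒩 : Network N T) (W : WVar N) (s : N) : ℝ :=
  (W.diag (𝒩.parent s) - 2 * W.off s + W.diag (some s)) * 𝒩.R s / (𝒩.R s ^ 2 + 𝒩.X s ^ 2)

/-- Reactive power loss on the edge above `s`. -/
def lossQ (𝒩 : Network N T) (W : WVar N) (s : N) : ℝ :=
  (W.diag (𝒩.parent s) - 2 * W.off s + W.diag (some s)) * 𝒩.X s / (𝒩.R s ^ 2 + 𝒩.X s ^ 2)

section Finite

variable [Fintype N] [Fintype T]

open Classical in
/-- The nodes of the subtree rooted at `k`: those reached from `k` by going to children. -/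
def subtree (𝒩 : Network N T) (k : N) : Finset N :=
  Finset.univ.filter (fun l => Relation.ReflTransGen (fun a b : N => 𝒩.parent b = some a) k l)

open Classical in
/-- The children of a node. -/
def children (𝒩 : Network N T) (l : N) : Finset N :=
  Finset.univ.filter (fun s => 𝒩.parent s = some l)

/-- Active power consumed by the subtree rooted at `k`, when type-`j` EVs at node `l` together
consume `Λ l j`. -/
def powerP (𝒩 : Network N T) (Λ : N → T → ℝ) (W : WVar N) (k : N) : ℝ :=
  ∑ l ∈ 𝒩.subtree k, ∑ j, Λ l j + ∑ l ∈ 𝒩.subtree k, ∑ s ∈ 𝒩.children l, 𝒩.lossP W s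

/-- Reactive power consumed by the subtree rooted at `k`. -/
def powerQ (𝒩 : Network N T) (W : WVar N) (k : N) : ℝ :=
  ∑ l ∈ 𝒩.subtree k, ∑ s ∈ 𝒩.children l, 𝒩.lossQ W s

/-- The voltage constraints without the rank condition: Kirchhoff's law, voltage limits, and
positive semidefiniteness of the edge matrices. -/
structure VoltageFeasible (𝒩 : Network N T) (Λ : N → T → ℝ) (W : WVar N) : Prop where
  feeder : W.diag none = 𝒩.V₀ ^ 2
  kirchhoff : ∀ k, W.off k - W.diag (some k) - 𝒩.powerP Λ W k * 𝒩.R k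
    - 𝒩.powerQ W k * 𝒩.X k = 0
  lower : ∀ k, 𝒩.vlo k ≤ W.diag (some k)
  upper : ∀ k, W.diag (some k) ≤ 𝒩.vhi k
  psd : ∀ k, (𝒩.edgeMatrix W k).PosSemidef

/-! ### The charging control rule -/

/-- Feasible charging rates `p` in state `z`, under the AC voltage model (with rank-one edge
matrices). -/
structure RateFeasible (𝒩 : Network N T) (z p : N → T → ℝ) : Prop where
  load : ∀ i, ∑ j, z i j * p i j ≤ 𝒩.M i
  nonneg : ∀ i j, 0 ≤ p i j
  le_cmax : ∀ i j, p i j ≤ 𝒩.cmax j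
  voltage : ∃ W : WVar N, 𝒩.VoltageFeasible (fun i j => z i j * p i j) W ∧
    ∀ k, (𝒩.edgeMatrix W k).rank = 1

/-- The aggregate utility; in `EReal`, `0 * (-∞) = 0`. -/
def rateObjective (𝒩 : Network N T) (z p : N → T → ℝ) : EReal :=
  ∑ i, ∑ j, (z i j : EReal) * 𝒩.u i j (p i j)

/-- `p` is the charging-rate vector in state `z`: an optimal feasible vector, with
`p i j = 0` where `z i j = 0`. -/
structure IsChargingRate (𝒩 : Network N T) (z p : N → T → ℝ) : Prop where
  feasible : 𝒩.RateFeasible z p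
  zero : ∀ i j, z i j = 0 → p i j = 0
  optimal : ∀ p', 𝒩.RateFeasible z p' → 𝒩.rateObjective z p' ≤ 𝒩.rateObjective z p

/-- The charging control rule `z ↦ p(z)`. -/
def rate (𝒩 : Network N T) (z : N → T → ℝ) : N → T → ℝ :=
  Classical.epsilon (fun p => 𝒩.IsChargingRate z p)

/-! ### The fluid model -/

/-- Total number of EVs at node `i`. -/
def total (q : ℝ → N → T → ℝ) (i : N) (t : ℝ) : ℝ := ∑ j, q t i j

open Classical in
/-- The admission rate `λ_ij 1{q_i(t) < K_i}`. -/
def admission (𝒩 : Network N T) (q : ℝ → N → T → ℝ) (i : N) (j : T) (t : ℝ) : ℝ :=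
  if total q i t < 𝒩.K i then 𝒩.lam i j else 0

/-- `z` is a fluid-model solution, where `q` gives the total numbers of EVs and `F₀ i j` is the
joint law of (charging requirement, parking time) of the initial type-`j` EVs at node `i`. -/
structure IsFluidSolution (𝒩 : Network N T) (F₀ : N → T → Measure (ℝ × ℝ))
    (q z : ℝ → N → T → ℝ) : Prop where
  nonneg : ∀ t, 0 ≤ t → ∀ i j, 0 ≤ z t i j
  continuous : ∀ i j, ContinuousOn (fun t => z t i j) (Ici 0)
  rate_integrable : ∀ i j t, 0 ≤ t →
    IntervalIntegrable (fun s => 𝒩.rate (z s) i j) volume 0 t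
  q_init : ∀ i j, 0 ≤ q 0 i j
  q_measurable : ∀ i j, Measurable (fun t => q t i j)
  q_eq : ∀ t, 0 ≤ t → ∀ i j,
    q t i j = q 0 i j * (F₀ i j).real {x | t ≤ x.2}
      + ∫ s in (0 : ℝ)..t, 𝒩.admission q i j s * (𝒩.F j).real {x | t - s ≤ x.2}
  z_eq : ∀ t, 0 ≤ t → ∀ i j,
    z t i j
      = z 0 i j * (F₀ i j).real {x | (∫ v in (0 : ℝ)..t, 𝒩.rate (z v) i j) < x.1 ∧ t ≤ x.2}
      + ∫ s in (0 : ℝ)..t, 𝒩.admission q i j s *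
          (𝒩.F j).real {x | (∫ v in s..t, 𝒩.rate (z v) i j) < x.1 ∧ t - s ≤ x.2}

/-- `z` is an invariant point: the constant function `z` is a fluid-model solution, for some
initial total population and initial laws. -/
def IsInvariantPoint (𝒩 : Network N T) (z : N → T → ℝ) : Prop :=
  ∃ (F₀ : N → T → Measure (ℝ × ℝ)) (q : ℝ → N → T → ℝ),
    (∀ i j, IsProbabilityMeasure (F₀ i j)) ∧ 𝒩.IsFluidSolution F₀ q (fun _ => z)

/-! ### The fixed-point equation and the optimal power flow problem -/

/-- Mean parking time. -/
def meanD (𝒩 : Network N T) (j : T) : ℝ := ∫ x, x.2 ∂𝒩.F j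

/-- Total arrival rate at a node. -/
def lamTot (𝒩 : Network N T) (i : N) : ℝ := ∑ j, 𝒩.lam i j

/-- The modified arrival rate `γ_ij`. -/
def gam (𝒩 : Network N T) (i : N) (j : T) : ℝ :=
  𝒩.lam i j / 𝒩.lamTot i *
    min (𝒩.lamTot i) (𝒩.K i * (∑ j', 𝒩.lam i j' / 𝒩.lamTot i * 𝒩.meanD j')⁻¹)

/-- `min {d, b / p}`, where `b / 0 = ∞`. -/
def sojourn (b d p : ℝ) : ℝ := if p = 0 then d else min d (b / p)

/-- `z ≥ 0` solves `z_ij = γ_ij E[min {D_j, B_j / p_ij(z)}]`. -/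
def IsFixedPoint (𝒩 : Network N T) (z : N → T → ℝ) : Prop :=
  (∀ i j, 0 ≤ z i j) ∧
    ∀ i j, z i j = 𝒩.gam i j * ∫ x, sojourn x.1 x.2 (𝒩.rate z i j) ∂𝒩.F j

/-- `g_ij(x) = γ_ij E[min {D_j x, B_j}]`. -/
def g (𝒩 : Network N T) (i : N) (j : T) (x : ℝ) : ℝ :=
  𝒩.gam i j * ∫ y, min (y.2 * x) y.1 ∂𝒩.F j

/-- The inverse of `g_ij : [0, c_j^max] → [0, g_ij(c_j^max)]`. -/
def gInv (𝒩 : Network N T) (i : N) (j : T) : ℝ → ℝ :=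
  Function.invFunOn (𝒩.g i j) (Icc 0 (𝒩.cmax j))

/-- `G` is a function on `[0, g_ij(c_j^max)]` with `G' = u_ij' ∘ g_ij⁻¹`: finite and continuous
except that the value at `0`, which is the limit there, may be `-∞`. -/
structure IsPrimitive (𝒩 : Network N T) (i : N) (j : T) (G : ℝ → EReal) : Prop where
  finite : ∀ y ∈ Ioc 0 (𝒩.g i j (𝒩.cmax j)), G y ≠ ⊥ ∧ G y ≠ ⊤
  continuous : ContinuousOn G (Icc 0 (𝒩.g i j (𝒩.cmax j)))
  hasDeriv : ∀ y ∈ Ioo 0 (𝒩.g i j (𝒩.cmax j)),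
    HasDerivAt (fun y => (G y).toReal) (derivE (𝒩.u i j) (𝒩.gInv i j y)) y

/-- Feasible points of the relaxed optimal power flow problem. -/
structure OPFFeasible (𝒩 : Network N T) (Λ : N → T → ℝ) (W : WVar N) : Prop where
  voltage : 𝒩.VoltageFeasible Λ W
  load : ∀ i, ∑ j, Λ i j ≤ 𝒩.M i
  nonneg : ∀ i j, 0 ≤ Λ i j
  le_max : ∀ i j, Λ i j ≤ 𝒩.g i j (𝒩.cmax j)

/-- `Λ` solves the relaxed optimal power flow problem with objective `∑ G_ij(Λ_ij)`: it is the
`Λ`-part of an optimal pair `(Λ, W)`. -/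
def IsOPFSolution (𝒩 : Network N T) (G : N → T → ℝ → EReal) (Λ : N → T → ℝ) : Prop :=
  (∃ W, 𝒩.OPFFeasible Λ W) ∧
    ∀ Λ' W', 𝒩.OPFFeasible Λ' W' → ∑ i, ∑ j, G i j (Λ' i j) ≤ ∑ i, ∑ j, G i j (Λ i j)

end Finite

end Network

end EVCharging

end

/-
(i) Divide the fluid equations by `t` and let `t → ∞`. At each node the population eventually stays
near the number `K` of parking spaces or never fills them, so the long-run fraction of admitted
arrivals is `min 1 (K / ∑ λ E[D])`, and a constant `z` has to equal this fraction times `λ` times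
the mean charging time.

(ii) The set of loads `Λ` that admit voltages is convex and downward closed, and on it the rank
condition can always be met, so it drops out of the charging problem. Hence `p` is the charging
rate in state `z` iff `Λ = z p` satisfies the first-order conditions with slopes `u'(p)`, and `Λ`
solves the optimal power flow problem iff it satisfies them with slopes `G'(Λ) = u'(g⁻¹(Λ))`.
When `z = Λ / p` is a fixed point, `Λ = g(p)` and the slopes agree; the infinite slope at `0` keeps
all optima positive. The condition on `inf (D / B)` makes `g` injective on `[0, c^max]`.
-/

noncomputable section

namespace EVCharging

section ERealSums

theorem coe_mul_lt_coe_mul {w r : ℝ} {a : EReal} (hw : 0 < w) (h : a < r) :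
    (w : EReal) * a < ((w * r : ℝ) : EReal) := by
  induction a with
  | bot => rw [EReal.coe_mul_bot_of_pos hw]; exact EReal.bot_lt_coe _
  | coe a =>
    rw [← EReal.coe_mul, EReal.coe_lt_coe_iff]
    exact mul_lt_mul_of_pos_left (EReal.coe_lt_coe_iff.1 h) hw
  | top => exact absurd h not_top_lt

variable {ι : Type*}

theorem ereal_coe_sum (s : Finset ι) (r : ι → ℝ) :
    ((∑ i ∈ s, r i : ℝ) : EReal) = ∑ i ∈ s, (r i : EReal) := by
  classical
  induction s using Finset.induction_on with
  | empty => simp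
  | insert a s ha ih => rw [Finset.sum_insert ha, Finset.sum_insert ha, EReal.coe_add, ih]

theorem sum_le_coe_sum {s : Finset ι} {a : ι → EReal} {r : ι → ℝ} (h : ∀ i ∈ s, a i ≤ r i) :
    ∑ i ∈ s, a i ≤ ((∑ i ∈ s, r i : ℝ) : EReal) := by
  rw [ereal_coe_sum]
  exact Finset.sum_le_sum h

theorem sum_lt_coe_sum {s : Finset ι} {a : ι → EReal} {r : ι → ℝ} (h : ∀ i ∈ s, a i ≤ r i)
    {k : ι} (hk : k ∈ s) (hlt : a k < r k) : ∑ i ∈ s, a i < ((∑ i ∈ s, r i : ℝ) : EReal) := by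
  classical
  rw [← Finset.add_sum_erase _ _ hk, ← Finset.add_sum_erase _ _ hk, EReal.coe_add]
  exact (add_le_add le_rfl (sum_le_coe_sum fun i hi => h i (Finset.mem_of_mem_erase hi))).trans_lt
    (EReal.add_lt_add_right_coe hlt _)

end ERealSums

/-- `φ` is the marginal of the strictly concave function `f` on `[0, c]`: the slope at every
positive point of a line that lies above `f`. It is infinite at `0`, where `f` itself may jump down
or be `-∞`. Both the utilities and the primitives `G_ij` are of this kind. -/
structure IsMarginal (c : ℝ) (f : ℝ → EReal) (φ : ℝ → ℝ) : Prop where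
  pos : 0 < c
  coe : ∀ x ∈ Ioc 0 c, ((f x).toReal : EReal) = f x
  tangent : ∀ x ∈ Ioc 0 c, ∀ y ∈ Icc 0 c, y ≠ x →
    f y < (((f x).toReal + φ x * (y - x) : ℝ) : EReal)
  continuousOn : ContinuousOn (fun x => (f x).toReal) (Ioc 0 c)
  continuousOn_marginal : ContinuousOn φ (Ioc 0 c)
  nonneg : ∀ x ∈ Ioc 0 c, 0 ≤ φ x
  slope : Tendsto φ (𝓝[>] 0) atTop

section Marginal

variable {c : ℝ} {f : ℝ → EReal} {φ : ℝ → ℝ}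

theorem IsMarginal.le_tangent (h : IsMarginal c f φ) {x y : ℝ} (hx : x ∈ Ioc 0 c)
    (hy : y ∈ Icc 0 c) : f y ≤ (((f x).toReal + φ x * (y - x) : ℝ) : EReal) := by
  rcases eq_or_ne y x with rfl | hne
  · simp [h.coe y hx]
  · exact (h.tangent x hx y hy hne).le

theorem IsMarginal.toReal_le_tangent (h : IsMarginal c f φ) {x y : ℝ} (hx : x ∈ Ioc 0 c)
    (hy : y ∈ Ioc 0 c) : (f y).toReal ≤ (f x).toReal + φ x * (y - x) := by
  have := h.le_tangent hx (Ioc_subset_Icc_self hy)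
  rwa [← h.coe y hy, EReal.coe_le_coe_iff] at this

theorem IsMarginal.antitoneOn (h : IsMarginal c f φ) : AntitoneOn φ (Ioc 0 c) := by
  intro x hx y hy hxy
  rcases hxy.eq_or_lt with rfl | hlt
  · exact le_rfl
  · nlinarith [h.toReal_le_tangent hx hy, h.toReal_le_tangent hy hx]

theorem lt_tangent_of_hasDerivAt {F : ℝ → ℝ} (hF : ContinuousOn F (Ioc 0 c))
    (hd : ∀ x ∈ Ioo 0 c, HasDerivAt F (φ x) x) (hφ : StrictAntiOn φ (Ioc 0 c))
    {x y : ℝ} (hx : x ∈ Ioc 0 c) (hy : y ∈ Ioc 0 c) (hne : y ≠ x) :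
    F y < F x + φ x * (y - x) := by
  have slope {a b : ℝ} (ha : a ∈ Ioc 0 c) (hb : b ∈ Ioc 0 c) (hab : a < b) :
      ∃ ξ ∈ Ioo a b, ξ ∈ Ioc 0 c ∧ φ ξ * (b - a) = F b - F a := by
    obtain ⟨ξ, hξ, e⟩ := exists_hasDerivAt_eq_slope F φ hab
      (hF.mono fun s hs => ⟨ha.1.trans_le hs.1, hs.2.trans hb.2⟩)
      (fun s hs => hd s ⟨ha.1.trans hs.1, hs.2.trans_le hb.2⟩)
    exact ⟨ξ, hξ, ⟨ha.1.trans hξ.1, hξ.2.le.trans hb.2⟩,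
      (eq_div_iff (sub_pos.2 hab).ne').1 e⟩
  rcases lt_or_gt_of_ne hne with hlt | hlt
  · obtain ⟨ξ, hξ, hξc, e⟩ := slope hy hx hlt
    nlinarith [hφ hξc hx hξ.2]
  · obtain ⟨ξ, hξ, hξc, e⟩ := slope hx hy hlt
    nlinarith [hφ hx hξc hξ.1]

theorem le_coe_of_forall_le_add_mul {l : EReal} {a b m : ℝ} (hm : 0 < m)
    (h : ∀ s ∈ Ioo 0 m, l ≤ ((a + b * s : ℝ) : EReal)) : l ≤ (a : EReal) := by
  have hlim : Tendsto (fun s : ℝ => ((a + b * s : ℝ) : EReal)) (𝓝[>] 0)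
      (𝓝 ((a + b * 0 : ℝ) : EReal)) :=
    ((continuous_coe_real_ereal.comp (by fun_prop)).tendsto 0).mono_left nhdsWithin_le_nhds
  rw [mul_zero, add_zero] at hlim
  refine ge_of_tendsto hlim ?_
  filter_upwards [Ioo_mem_nhdsGT hm] with s hs using h s hs

theorem IsMarginal.of_hasDerivAt (hc : 0 < c) (hfin : ∀ x ∈ Ioc 0 c, f x ≠ ⊥ ∧ f x ≠ ⊤)
    (h0 : ∀ x ∈ Ioc 0 c, f 0 ≤ f x) (hf : ContinuousOn (fun x => (f x).toReal) (Ioc 0 c))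
    (hd : ∀ x ∈ Ioo 0 c, HasDerivAt (fun x => (f x).toReal) (φ x) x)
    (hφ : StrictAntiOn φ (Ioc 0 c)) (hφc : ContinuousOn φ (Ioc 0 c))
    (hφ0 : ∀ x ∈ Ioc 0 c, 0 ≤ φ x) (hs : Tendsto φ (𝓝[>] 0) atTop) : IsMarginal c f φ := by
  have hcoe : ∀ x ∈ Ioc 0 c, ((f x).toReal : EReal) = f x := fun x hx =>
    EReal.coe_toReal (hfin x hx).2 (hfin x hx).1
  have htan : ∀ x ∈ Ioc 0 c, ∀ y ∈ Ioc 0 c, y ≠ x →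
      (f y).toReal < (f x).toReal + φ x * (y - x) :=
    fun x hx y hy => lt_tangent_of_hasDerivAt hf hd hφ hx hy
  refine ⟨hc, hcoe, fun x hx y hy hne => ?_, hf, hφc, hφ0, hs⟩
  rcases hy.1.eq_or_lt with rfl | hpos
  · -- At `0` the tangent at `x / 2` gives a weak inequality in the limit, and it lies strictly
    -- below the tangent at `x` there.
    have hx0 := hx.1
    have hm : x / 2 ∈ Ioc 0 c := ⟨by linarith, by linarith [hx.2]⟩
    have hweak : f 0 ≤ (((f (x / 2)).toReal - φ (x / 2) * (x / 2) : ℝ) : EReal) := by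
      refine le_coe_of_forall_le_add_mul (b := φ (x / 2)) hm.1 fun s hs => ?_
      have hs' : s ∈ Ioc 0 c := ⟨hs.1, hs.2.le.trans hm.2⟩
      refine (h0 s hs').trans ?_
      rw [← hcoe s hs', EReal.coe_le_coe_iff]
      linarith [htan _ hm s hs' hs.2.ne]
    refine hweak.trans_lt (EReal.coe_lt_coe_iff.2 ?_)
    nlinarith [htan x hx _ hm (by linarith), hφ hm hx (by linarith)]
  · have hy' : y ∈ Ioc 0 c := ⟨hpos, hy.2⟩
    rw [← hcoe y hy']
    exact EReal.coe_lt_coe_iff.2 (htan x hx y hy' hne)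

theorem IsMarginal.const_mul (h : IsMarginal c f φ) {w : ℝ} (hw : 0 < w) :
    IsMarginal c (fun x => (w : EReal) * f x) (fun x => w * φ x) := by
  have htr : ∀ x, ((w : EReal) * f x).toReal = w * (f x).toReal := fun x => by
    rw [EReal.toReal_mul, EReal.toReal_coe]
  refine ⟨h.pos, fun x hx => ?_, fun x hx y hy hne => ?_, ?_,
    continuousOn_const.mul h.continuousOn_marginal,
    fun x hx => mul_nonneg hw.le (h.nonneg x hx), h.slope.const_mul_atTop hw⟩
  · rw [htr, EReal.coe_mul, h.coe x hx]
  · rw [htr, mul_assoc, ← mul_add]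
    exact coe_mul_lt_coe_mul hw (h.tangent x hx y hy hne)
  · simp only [htr]
    exact continuousOn_const.mul h.continuousOn

theorem IsMarginal.strictConcaveOnE (h : IsMarginal c f φ) : StrictConcaveOnE (Icc 0 c) f := by
  intro x hx y hy hne a b ha hb hab
  have hm : a * x + b * y ∈ Ioc 0 c := by
    refine ⟨?_, (convex_Icc 0 c hx hy ha.le hb.le hab).2⟩
    rcases hx.1.eq_or_lt with rfl | hx0
    · simpa using mul_pos hb (hy.1.lt_of_ne hne)
    · exact add_pos_of_pos_of_nonneg (mul_pos ha hx0) (mul_nonneg hb.le hy.1)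
  obtain rfl : a = 1 - b := by linarith
  have hxm : x ≠ (1 - b) * x + b * y := fun e =>
    hne (mul_left_cancel₀ hb.ne' (by linarith : b * x = b * y))
  have hym : y ≠ (1 - b) * x + b * y := fun e =>
    hne (mul_left_cancel₀ ha.ne' (by linarith : (1 - b) * x = (1 - b) * y))
  have htan := EReal.add_lt_add (coe_mul_lt_coe_mul ha (h.tangent _ hm x hx hxm))
    (coe_mul_lt_coe_mul hb (h.tangent _ hm y hy hym))
  refine htan.trans_eq ?_
  conv_rhs => rw [← h.coe _ hm]
  rw [← EReal.coe_add, EReal.coe_eq_coe_iff]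
  ring

theorem IsMarginal.neg_le_mul_sub (h : IsMarginal c f φ) {e x : ℝ} (he : e ∈ Ioc 0 c)
    (hx : x ∈ Ioc 0 c) : -(φ e * c) ≤ φ x * (e - x) := by
  rcases le_total x e with hle | hle
  · have := mul_nonneg (h.nonneg _ hx) (sub_nonneg.2 hle)
    have := mul_nonneg (h.nonneg _ he) h.pos.le
    linarith
  · have := mul_le_mul (h.antitoneOn he hx hle) (by linarith [he.1, hx.2] : x - e ≤ c)
      (sub_nonneg.2 hle) (h.nonneg _ he)
    linarith

end Marginal

section Optimization

variable {ι : Type*} [Fintype ι] {c : ι → ℝ} {f : ι → ℝ → EReal} {φ : ι → ℝ → ℝ}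

theorem coe_sum_toReal (hf : ∀ i, IsMarginal (c i) (f i) (φ i)) {x : ι → ℝ}
    (hx : ∀ i, x i ∈ Ioc 0 (c i)) :
    ((∑ i, (f i (x i)).toReal : ℝ) : EReal) = ∑ i, f i (x i) := by
  rw [ereal_coe_sum]
  exact Finset.sum_congr rfl fun i _ => (hf i).coe _ (hx i)

theorem sum_lt_of_firstOrder (hf : ∀ i, IsMarginal (c i) (f i) (φ i)) {x y : ι → ℝ}
    (hx : ∀ i, x i ∈ Ioc 0 (c i)) (hy : ∀ i, y i ∈ Icc 0 (c i)) (hne : y ≠ x)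
    (hfo : ∑ i, φ i (x i) * (y i - x i) ≤ 0) :
    ∑ i, f i (y i) < ∑ i, f i (x i) := by
  obtain ⟨k, hk⟩ := Function.ne_iff.1 hne
  refine (sum_lt_coe_sum (fun i _ => (hf i).le_tangent (hx i) (hy i)) (Finset.mem_univ k)
    ((hf k).tangent _ (hx k) _ (hy k) hk)).trans_le ?_
  rw [← coe_sum_toReal hf hx, EReal.coe_le_coe_iff, Finset.sum_add_distrib]
  linarith

theorem firstOrder_of_isMaxOn (hf : ∀ i, IsMarginal (c i) (f i) (φ i)) {C : Set (ι → ℝ)}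
    (hC : Convex ℝ C) (hbox : ∀ x ∈ C, ∀ i, x i ∈ Ioc 0 (c i)) {x : ι → ℝ} (hx : x ∈ C)
    (hmax : IsMaxOn (fun x => ∑ i, (f i (x i)).toReal) C x) {y : ι → ℝ} (hy : y ∈ C) :
    ∑ i, φ i (x i) * (y i - x i) ≤ 0 := by
  let w : ℝ → ι → ℝ := fun t => x + t • (y - x)
  have hwC : ∀ t ∈ Ioo (0 : ℝ) 1, w t ∈ C := fun t ht =>
    hC.add_smul_sub_mem hx hy ⟨ht.1.le, ht.2.le⟩
  have hle : ∀ t ∈ Ioo (0 : ℝ) 1, ∑ i, φ i (w t i) * (y i - x i) ≤ 0 := by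
    intro t ht
    have htan : ∑ i, (f i (x i)).toReal ≤
        ∑ i, ((f i (w t i)).toReal + φ i (w t i) * (x i - w t i)) :=
      Finset.sum_le_sum fun i _ => (hf i).toReal_le_tangent (hbox _ (hwC t ht) i) (hbox x hx i)
    have hdir : ∑ i, φ i (w t i) * (x i - w t i) = -t * ∑ i, φ i (w t i) * (y i - x i) := by
      rw [Finset.mul_sum]
      refine Finset.sum_congr rfl fun i _ => ?_
      simp only [w, Pi.add_apply, Pi.smul_apply, Pi.sub_apply, smul_eq_mul]
      ring
    rw [Finset.sum_add_distrib, hdir] at htan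
    have hopt : ∑ i, (f i (w t i)).toReal ≤ ∑ i, (f i (x i)).toReal := hmax (hwC t ht)
    nlinarith [ht.1]
  have hunit : Ioo (0 : ℝ) 1 ∈ 𝓝[>] 0 := Ioo_mem_nhdsGT zero_lt_one
  have hlim : Tendsto (fun t => ∑ i, φ i (w t i) * (y i - x i)) (𝓝[>] 0)
      (𝓝 (∑ i, φ i (x i) * (y i - x i))) := by
    refine tendsto_finsetSum _ fun i _ => Tendsto.mul_const _ ?_
    refine ((hf i).continuousOn_marginal (x i) (hbox x hx i)).tendsto.comp
      (tendsto_nhdsWithin_iff.2 ⟨?_, ?_⟩)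
    · have hw : Continuous fun t => w t i := by fun_prop
      simpa [w] using (hw.tendsto 0).mono_left (nhdsWithin_le_nhds (s := Ioi 0))
    · filter_upwards [hunit] with t ht using hbox _ (hwC t ht) i
  refine le_of_tendsto hlim ?_
  filter_upwards [hunit] with t ht using hle t ht

-- If a coordinate of `x` is tiny, its huge marginal makes the move towards `e` profitable.
theorem exists_pos_le_of_firstOrder (hf : ∀ i, IsMarginal (c i) (f i) (φ i)) {e : ι → ℝ}
    (he : ∀ i, e i ∈ Ioc 0 (c i)) :
    ∃ η > 0, ∀ x : ι → ℝ, (∀ i, x i ∈ Ioc 0 (c i)) → ∑ i, φ i (x i) * (e i - x i) ≤ 0 →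
      ∀ i, η ≤ x i := by
  set A : ℝ := ∑ i, φ i (e i) * c i
  have hev : ∀ᶠ s in 𝓝[>] (0 : ℝ), ∀ k, s < e k / 2 ∧ A / (e k / 2) < φ k s :=
    eventually_all.2 fun k =>
      ((eventually_lt_nhds (half_pos (he k).1)).filter_mono nhdsWithin_le_nhds).and
        ((hf k).slope.eventually_gt_atTop _)
  obtain ⟨η, hη, hsmall⟩ := mem_nhdsGT_iff_exists_Ioo_subset.1 hev
  refine ⟨η, hη, fun x hx hfo k => not_lt.1 fun hk => ?_⟩
  obtain ⟨hxe, hφ⟩ := hsmall ⟨(hx k).1, hk⟩ k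
  have hgain : A < φ k (x k) * (e k - x k) := by
    rw [div_lt_iff₀ (half_pos (he k).1)] at hφ
    exact hφ.trans_le (mul_le_mul_of_nonneg_left (by linarith) ((hf k).nonneg _ (hx k)))
  have hterm : ∀ i, 0 ≤ φ i (x i) * (e i - x i) + φ i (e i) * c i := fun i => by
    linarith [(hf i).neg_le_mul_sub (he i) (hx i)]
  have hsum := Finset.single_le_sum (fun i _ => hterm i) (Finset.mem_univ k)
  rw [Finset.sum_add_distrib] at hsum
  linarith [mul_nonneg ((hf k).nonneg _ (he k)) (hf k).pos.le]

-- Maximize over the points of `C` with all coordinates at least `η / 2`; by the bound `η` of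
-- `exists_pos_le_of_firstOrder` this constraint is inactive at the maximizer.
theorem exists_firstOrder (hf : ∀ i, IsMarginal (c i) (f i) (φ i)) {C : Set (ι → ℝ)}
    (hC : Convex ℝ C) (hK : IsCompact C) (hbox : ∀ x ∈ C, ∀ i, x i ∈ Icc 0 (c i)) {e : ι → ℝ}
    (heC : e ∈ C) (he : ∀ i, 0 < e i) :
    ∃ x ∈ C, (∀ i, 0 < x i) ∧ ∀ y ∈ C, ∑ i, φ i (x i) * (y i - x i) ≤ 0 := by
  have he' : ∀ i, e i ∈ Ioc 0 (c i) := fun i => ⟨he i, (hbox e heC i).2⟩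
  obtain ⟨η, hη, hbound⟩ := exists_pos_le_of_firstOrder hf he'
  set Cη : Set (ι → ℝ) := C ∩ Ici (fun _ => η / 2)
  have hboxη : ∀ x ∈ Cη, ∀ i, x i ∈ Ioc 0 (c i) := fun x hx i =>
    ⟨(half_pos hη).trans_le (hx.2 i), (hbox x hx.1 i).2⟩
  have heη : e ∈ Cη := ⟨heC, fun i => by linarith [hbound e he' (by simp) i]⟩
  obtain ⟨x, hx, hmax⟩ := (hK.inter_right isClosed_Ici).exists_isMaxOn ⟨e, heη⟩
    (f := fun x => ∑ i, (f i (x i)).toReal)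
    (continuousOn_finsetSum _ fun i _ =>
      (hf i).continuousOn.comp (continuous_apply i).continuousOn fun x hx => hboxη x hx i)
  have hfo : ∀ y ∈ Cη, ∑ i, φ i (x i) * (y i - x i) ≤ 0 := fun y hy =>
    firstOrder_of_isMaxOn hf (hC.inter (convex_Ici _)) hboxη hx hmax hy
  have hxη : ∀ i, η ≤ x i := hbound x (hboxη x hx) (hfo e heη)
  refine ⟨x, hx.1, fun i => (hboxη x hx i).1, fun y hy => ?_⟩
  have hmid : midpoint ℝ x y ∈ Cη := ⟨hC.midpoint_mem hx.1 hy, fun i => by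
    simp only [pi_midpoint_apply, midpoint_eq_smul_add, smul_eq_mul, invOf_eq_inv]
    linarith [hxη i, (hbox y hy i).1]⟩
  have hhalf : ∑ i, φ i (x i) * (midpoint ℝ x y i - x i)
      = 2⁻¹ * ∑ i, φ i (x i) * (y i - x i) := by
    rw [Finset.mul_sum]
    refine Finset.sum_congr rfl fun i _ => ?_
    simp only [pi_midpoint_apply, midpoint_eq_smul_add, smul_eq_mul, invOf_eq_inv]
    ring
  linarith [hfo _ hmid, hhalf]

theorem exists_strict_maximizer (hf : ∀ i, IsMarginal (c i) (f i) (φ i)) {C : Set (ι → ℝ)}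
    (hC : Convex ℝ C) (hK : IsCompact C) (hbox : ∀ x ∈ C, ∀ i, x i ∈ Icc 0 (c i)) {e : ι → ℝ}
    (heC : e ∈ C) (he : ∀ i, 0 < e i) :
    ∃ x ∈ C, (∀ i, 0 < x i) ∧ (∀ y ∈ C, ∑ i, φ i (x i) * (y i - x i) ≤ 0) ∧
      ∀ y ∈ C, y ≠ x → ∑ i, f i (y i) < ∑ i, f i (x i) := by
  obtain ⟨x, hx, hpos, hfo⟩ := exists_firstOrder hf hC hK hbox heC he
  exact ⟨x, hx, hpos, hfo, fun y hy hne =>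
    sum_lt_of_firstOrder hf (fun i => ⟨hpos i, (hbox x hx i).2⟩) (hbox y hy) hne (hfo y hy)⟩

end Optimization

section TwoByTwo

variable {a b d : ℝ}

theorem quadratic_form_nonneg (ha : 0 ≤ a) (hd : 0 ≤ d) (h : b ^ 2 ≤ a * d) (x y : ℝ) :
    0 ≤ a * x ^ 2 + 2 * b * (x * y) + d * y ^ 2 := by
  have hsq : (-(2 * b * (x * y))) ^ 2 ≤ (a * x ^ 2 + d * y ^ 2) ^ 2 := by
    nlinarith [mul_le_mul_of_nonneg_right h (sq_nonneg (x * y)), sq_nonneg (a * x ^ 2 - d * y ^ 2)]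
  have := le_of_abs_le (abs_le_of_sq_le_sq hsq (by positivity))
  linarith

theorem posSemidef_two_iff :
    (!![a, b; b, d] : Matrix (Fin 2) (Fin 2) ℝ).PosSemidef ↔ 0 ≤ a ∧ 0 ≤ d ∧ b ^ 2 ≤ a * d := by
  constructor
  · intro h
    have hdet := h.det_nonneg
    rw [Matrix.det_fin_two_of] at hdet
    exact ⟨h.diag_nonneg (i := 0), h.diag_nonneg (i := 1), by linarith⟩
  · rintro ⟨ha, hd, h⟩
    rw [Matrix.posSemidef_iff_dotProduct_mulVec]
    refine ⟨by ext i j; fin_cases i <;> fin_cases j <;> simp, fun x => ?_⟩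
    refine (quadratic_form_nonneg ha hd h (x 0) (x 1)).trans_eq ?_
    simp only [dotProduct, Matrix.mulVec, Fin.sum_univ_two, Pi.star_apply, star_trivial,
      Matrix.of_apply, Matrix.cons_val_zero, Matrix.cons_val_one]
    ring

theorem rank_two_eq_one (hd : 0 < d) (h : b ^ 2 = a * d) :
    (!![a, b; b, d] : Matrix (Fin 2) (Fin 2) ℝ).rank = 1 := by
  have hprod : (!![a, b; b, d] : Matrix (Fin 2) (Fin 2) ℝ)
      = Matrix.vecMulVec ![b, d] ![b / d, 1] := by
    have ha : a = b * (b / d) := by field_simp; linarith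
    have hb : b = d * (b / d) := by field_simp
    ext i j
    fin_cases i <;> fin_cases j <;> simp [Matrix.vecMulVec_apply, ← ha, ← hb]
  refine le_antisymm (hprod ▸ Matrix.rank_vecMulVec_le _ _) ?_
  rw [Nat.one_le_iff_ne_zero, Ne, Matrix.rank, Submodule.finrank_eq_zero, LinearMap.range_eq_bot]
  intro hzero
  have : d = 0 := by simpa using congrFun (LinearMap.congr_fun hzero ![0, 1]) 1
  exact hd.ne' this

end TwoByTwo

section Tree

variable {N : Type*} {parent : N → Option N}

theorem exists_potential (htree : WellFounded fun a b => parent b = some a) (v₀ : ℝ)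
    (drop : N → ℝ) :
    ∃ v : Option N → ℝ, v none = v₀ ∧ ∀ k, v (some k) = v (parent k) - drop k := by
  let step : (k : N) → ((l : N) → parent k = some l → ℝ) → ℝ := fun k rec =>
    (match hp : parent k with
      | none => v₀
      | some l => rec l hp) - drop k
  refine ⟨fun o => o.elim v₀ (htree.fix step), rfl, fun k => ?_⟩
  change htree.fix step k = _
  rw [htree.fix_eq step k]
  simp only [step]
  split <;> simp_all

theorem node_induction (htree : WellFounded fun a b => parent b = some a) {P : Option N → Prop}
    (root : P none) (child : ∀ k, P (parent k) → P (some k)) : ∀ o, P o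
  | none => root
  | some k => by
    induction k using htree.induction with
    | _ k ih =>
      refine child k ?_
      match hp : parent k with
      | none => exact root
      | some l => exact ih l hp

end Tree

namespace Network

section Edge

variable {N T : Type*} {𝒩 : Network N T} {W W' : WVar N}

/-- Squared impedance `R² + X²` of the edge above `k`. -/
def impSq (𝒩 : Network N T) (k : N) : ℝ := 𝒩.R k ^ 2 + 𝒩.X k ^ 2

/-- Squared current `L_pk` on the edge above `k`. -/
def current (𝒩 : Network N T) (W : WVar N) (k : N) : ℝ :=
  (W.diag (𝒩.parent k) - 2 * W.off k + W.diag (some k)) / 𝒩.impSq k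

/-- The linear combination `a W + b W'` of two vectors of voltage variables. -/
def WVar.combo (a b : ℝ) (W W' : WVar N) : WVar N :=
  ⟨a • W.diag + b • W'.diag, a • W.off + b • W'.off⟩

theorem current_combo (𝒩 : Network N T) (a b : ℝ) (W W' : WVar N) :
    𝒩.current (W.combo a b W') = a • 𝒩.current W + b • 𝒩.current W' := by
  ext k
  simp only [current, WVar.combo, Pi.add_apply, Pi.smul_apply, smul_eq_mul]
  ring

theorem edgeMatrix_combo (𝒩 : Network N T) (a b : ℝ) (W W' : WVar N) (k : N) :
    𝒩.edgeMatrix (W.combo a b W') k = a • 𝒩.edgeMatrix W k + b • 𝒩.edgeMatrix W' k := by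
  ext i j
  fin_cases i <;> fin_cases j <;> simp [edgeMatrix, WVar.combo]

theorem Standing.impSq_pos (h : 𝒩.Standing) (k : N) : 0 < 𝒩.impSq k := by
  rcases h.impedance k with hk | hk
  · exact add_pos_of_pos_of_nonneg (sq_pos_of_ne_zero hk) (sq_nonneg _)
  · exact add_pos_of_nonneg_of_pos (sq_nonneg _) (sq_pos_of_ne_zero hk)

theorem Standing.diag_parent (h : 𝒩.Standing) (W : WVar N) (k : N) :
    W.diag (𝒩.parent k) = 2 * W.off k - W.diag (some k) + 𝒩.impSq k * 𝒩.current W k := by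
  rw [current, mul_div_cancel₀ _ (h.impSq_pos k).ne']
  ring

end Edge

section PowerFlow

variable {N T : Type*} [Fintype N] [Fintype T] {𝒩 : Network N T} {Λ Λ' : N → T → ℝ}
  {L L' : N → ℝ} {W W' : WVar N}

/-- The quantity `P R + Q X` on the edge above `k`, as a function of the loads `Λ` and of the
squared currents `L`; by Kirchhoff's law it equals `W_pk - W_kk`. -/
def lineDrop (𝒩 : Network N T) (Λ : N → T → ℝ) (L : N → ℝ) (k : N) : ℝ :=
  (∑ l ∈ 𝒩.subtree k, ∑ j, Λ l j + ∑ l ∈ 𝒩.subtree k, ∑ s ∈ 𝒩.children l, L s * 𝒩.R s) * 𝒩.R k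
    + (∑ l ∈ 𝒩.subtree k, ∑ s ∈ 𝒩.children l, L s * 𝒩.X s) * 𝒩.X k

theorem lineDrop_current (𝒩 : Network N T) (Λ : N → T → ℝ) (W : WVar N) (k : N) :
    𝒩.lineDrop Λ (𝒩.current W) k = 𝒩.powerP Λ W k * 𝒩.R k + 𝒩.powerQ W k * 𝒩.X k := by
  simp only [lineDrop, powerP, powerQ, lossP, lossQ, current, impSq, div_mul_eq_mul_div]

theorem lineDrop_add (𝒩 : Network N T) (Λ Λ' : N → T → ℝ) (L L' : N → ℝ) :
    𝒩.lineDrop (Λ + Λ') (L + L') = 𝒩.lineDrop Λ L + 𝒩.lineDrop Λ' L' := by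
  ext k
  simp only [lineDrop, Pi.add_apply, add_mul, Finset.sum_add_distrib]
  ring

theorem lineDrop_smul (𝒩 : Network N T) (a : ℝ) (Λ : N → T → ℝ) (L : N → ℝ) :
    𝒩.lineDrop (a • Λ) (a • L) = a • 𝒩.lineDrop Λ L := by
  ext k
  simp only [lineDrop, Pi.smul_apply, smul_eq_mul, mul_assoc, ← Finset.mul_sum]
  ring

theorem lineDrop_zero (𝒩 : Network N T) : 𝒩.lineDrop 0 0 = 0 := by
  simpa using 𝒩.lineDrop_smul 0 0 0

theorem Standing.lineDrop_mono (h : 𝒩.Standing) (hΛ : Λ ≤ Λ') (hL : L ≤ L') :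
    𝒩.lineDrop Λ L ≤ 𝒩.lineDrop Λ' L' := by
  intro k
  have hR := h.R_nonneg
  have hX := h.X_nonneg
  have := hR k
  have := hX k
  unfold lineDrop
  gcongr with l _ j _ l _ s _ l _ s _
  exacts [hΛ l j, hR s, hL s, hX s, hL s]

theorem Standing.lineDrop_nonneg (h : 𝒩.Standing) (hΛ : 0 ≤ Λ) (hL : 0 ≤ L) :
    0 ≤ 𝒩.lineDrop Λ L :=
  𝒩.lineDrop_zero.symm.trans_le (h.lineDrop_mono hΛ hL)

/-- The power-flow equations: `W` describes the voltages that result from the loads `Λ` and the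
squared currents `L`. -/
structure IsFlow (𝒩 : Network N T) (Λ : N → T → ℝ) (L : N → ℝ) (W : WVar N) : Prop where
  feeder : W.diag none = 𝒩.V₀ ^ 2
  current_eq : 𝒩.current W = L
  off_eq : ∀ k, W.off k = W.diag (some k) + 𝒩.lineDrop Λ L k

theorem Standing.exists_isFlow (h : 𝒩.Standing) (Λ : N → T → ℝ) (L : N → ℝ) :
    ∃ W, 𝒩.IsFlow Λ L W := by
  obtain ⟨v, hv0, hv⟩ := exists_potential h.tree (𝒩.V₀ ^ 2)
    (fun k => 2 * 𝒩.lineDrop Λ L k + 𝒩.impSq k * L k)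
  refine ⟨⟨v, fun k => v (some k) + 𝒩.lineDrop Λ L k⟩, hv0, funext fun k => ?_, fun _ => rfl⟩
  rw [current, div_eq_iff (h.impSq_pos k).ne']
  linarith [hv k]

theorem isFlow_zero (𝒩 : Network N T) :
    𝒩.IsFlow 0 0 ⟨fun _ => 𝒩.V₀ ^ 2, fun _ => 𝒩.V₀ ^ 2⟩ := by
  refine ⟨rfl, funext fun k => ?_, fun k => ?_⟩
  · simp only [current, Pi.zero_apply]
    ring
  · simp [lineDrop_zero]

theorem IsFlow.combo (hW : 𝒩.IsFlow Λ L W) (hW' : 𝒩.IsFlow Λ' L' W') {a b : ℝ}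
    (hab : a + b = 1) : 𝒩.IsFlow (a • Λ + b • Λ') (a • L + b • L') (W.combo a b W') := by
  refine ⟨?_, ?_, fun k => ?_⟩
  · simp [WVar.combo, hW.feeder, hW'.feeder, ← add_mul, hab]
  · rw [current_combo, hW.current_eq, hW'.current_eq]
  · simp only [WVar.combo, lineDrop_add, lineDrop_smul, Pi.add_apply, Pi.smul_apply, smul_eq_mul,
      hW.off_eq k, hW'.off_eq k]
    ring

theorem IsFlow.diag_parent_eq (hW : 𝒩.IsFlow Λ L W) (h : 𝒩.Standing) (k : N) :
    W.diag (𝒩.parent k) = W.diag (some k) + (2 * 𝒩.lineDrop Λ L k + 𝒩.impSq k * L k) := by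
  rw [h.diag_parent W k, hW.current_eq, hW.off_eq k]
  ring

theorem IsFlow.sq_off_le_iff (hW : 𝒩.IsFlow Λ L W) (h : 𝒩.Standing) (k : N) :
    W.off k ^ 2 ≤ W.diag (𝒩.parent k) * W.diag (some k) ↔
      𝒩.lineDrop Λ L k ^ 2 ≤ 𝒩.impSq k * L k * W.diag (some k) := by
  rw [hW.diag_parent_eq h k, hW.off_eq k, ← sub_nonneg, ← sub_nonneg (b := 𝒩.lineDrop Λ L k ^ 2)]
  ring_nf

theorem IsFlow.voltageFeasible (hW : 𝒩.IsFlow Λ L W) (h : 𝒩.Standing) (hΛ : 0 ≤ Λ) (hL : 0 ≤ L)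
    (hlow : ∀ k, 𝒩.vlo k ≤ W.diag (some k))
    (hsq : ∀ k, 𝒩.lineDrop Λ L k ^ 2 ≤ 𝒩.impSq k * L k * W.diag (some k)) :
    𝒩.VoltageFeasible Λ W := by
  have hdec : ∀ k, W.diag (some k) ≤ W.diag (𝒩.parent k) := fun k => by
    have hdrop : 0 ≤ 𝒩.lineDrop Λ L k := h.lineDrop_nonneg hΛ hL k
    have hloss : 0 ≤ 𝒩.impSq k * L k := mul_nonneg (h.impSq_pos k).le (hL k)
    linarith [hW.diag_parent_eq h k]
  have hup : ∀ o, W.diag o ≤ 𝒩.V₀ ^ 2 :=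
    node_induction h.tree hW.feeder.le fun k hk => (hdec k).trans hk
  have hpos : ∀ k, 0 ≤ W.diag (some k) := fun k => (h.vlo_pos k).le.trans (hlow k)
  refine ⟨hW.feeder, fun k => ?_, hlow, fun k => (hup _).trans (h.le_vhi k), fun k =>
    posSemidef_two_iff.2 ⟨(hpos k).trans (hdec k), hpos k, (hW.sq_off_le_iff h k).2 (hsq k)⟩⟩
  have hoff := hW.off_eq k
  rw [← hW.current_eq, lineDrop_current] at hoff
  linarith

theorem VoltageFeasible.isFlow (hW : 𝒩.VoltageFeasible Λ W) : 𝒩.IsFlow Λ (𝒩.current W) W := by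
  refine ⟨hW.feeder, rfl, fun k => ?_⟩
  rw [lineDrop_current]
  linarith [hW.kirchhoff k]

theorem VoltageFeasible.diag_pos (hW : 𝒩.VoltageFeasible Λ W) (h : 𝒩.Standing) (k : N) :
    0 < W.diag (some k) := (h.vlo_pos k).trans_le (hW.lower k)

theorem VoltageFeasible.sq_lineDrop_le (hW : 𝒩.VoltageFeasible Λ W) (h : 𝒩.Standing) (k : N) :
    𝒩.lineDrop Λ (𝒩.current W) k ^ 2 ≤ 𝒩.impSq k * 𝒩.current W k * W.diag (some k) :=
  (hW.isFlow.sq_off_le_iff h k).1 (posSemidef_two_iff.1 (hW.psd k)).2.2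

/-- The least squared current on the edge above `k` that the positive semidefiniteness constraint
allows when the line drop and the voltage at `k` are those of `W`. -/
def tightCurrent (𝒩 : Network N T) (Λ : N → T → ℝ) (W : WVar N) (k : N) : ℝ :=
  𝒩.lineDrop Λ (𝒩.current W) k ^ 2 / (𝒩.impSq k * W.diag (some k))

theorem VoltageFeasible.tightCurrent_le (hW : 𝒩.VoltageFeasible Λ W) (h : 𝒩.Standing) :
    𝒩.tightCurrent Λ W ≤ 𝒩.current W := by
  intro k
  rw [tightCurrent, div_le_iff₀ (mul_pos (h.impSq_pos k) (hW.diag_pos h k))]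
  linarith [hW.sq_lineDrop_le h k]

theorem VoltageFeasible.tightCurrent_nonneg (hW : 𝒩.VoltageFeasible Λ W) (h : 𝒩.Standing) :
    0 ≤ 𝒩.tightCurrent Λ W := fun k =>
  div_nonneg (sq_nonneg _) (mul_pos (h.impSq_pos k) (hW.diag_pos h k)).le

theorem VoltageFeasible.sq_lineDrop_eq (hW : 𝒩.VoltageFeasible Λ W) (h : 𝒩.Standing) (k : N) :
    𝒩.lineDrop Λ (𝒩.current W) k ^ 2 = 𝒩.impSq k * 𝒩.tightCurrent Λ W k * W.diag (some k) := by
  have := h.impSq_pos k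
  have := hW.diag_pos h k
  rw [tightCurrent]
  field_simp

theorem IsFlow.diag_mono (hW : 𝒩.IsFlow Λ L W) (hW' : 𝒩.IsFlow Λ L' W') (h : 𝒩.Standing)
    (hL : L' ≤ L) : W.diag ≤ W'.diag := by
  refine node_induction h.tree (by rw [hW.feeder, hW'.feeder]) fun k hk => ?_
  have hdrop : 𝒩.lineDrop Λ L' k ≤ 𝒩.lineDrop Λ L k := h.lineDrop_mono le_rfl hL k
  have hloss := mul_le_mul_of_nonneg_left (hL k) (h.impSq_pos k).le
  linarith [hW.diag_parent_eq h k, hW'.diag_parent_eq h k]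

-- Smaller currents raise all voltages and lower all line drops, so the constraints persist.
theorem VoltageFeasible.exists_current_eq_tightCurrent (hW : 𝒩.VoltageFeasible Λ W)
    (h : 𝒩.Standing) (hΛ : 0 ≤ Λ) :
    ∃ W', 𝒩.VoltageFeasible Λ W' ∧ 𝒩.current W' = 𝒩.tightCurrent Λ W := by
  have hle := hW.tightCurrent_le h
  have hnonneg := hW.tightCurrent_nonneg h
  obtain ⟨W', hW'⟩ := h.exists_isFlow Λ (𝒩.tightCurrent Λ W)
  have hv : W.diag ≤ W'.diag := hW.isFlow.diag_mono hW' h hle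
  refine ⟨W', hW'.voltageFeasible h hΛ hnonneg (fun k => (hW.lower k).trans (hv _)) fun k => ?_,
    hW'.current_eq⟩
  calc 𝒩.lineDrop Λ (𝒩.tightCurrent Λ W) k ^ 2
      ≤ 𝒩.lineDrop Λ (𝒩.current W) k ^ 2 :=
        pow_le_pow_left₀ (h.lineDrop_nonneg hΛ hnonneg k) (h.lineDrop_mono le_rfl hle k) 2
    _ = 𝒩.impSq k * 𝒩.tightCurrent Λ W k * W.diag (some k) := hW.sq_lineDrop_eq h k
    _ ≤ 𝒩.impSq k * 𝒩.tightCurrent Λ W k * W'.diag (some k) :=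
        mul_le_mul_of_nonneg_left (hv _) (mul_nonneg (h.impSq_pos k).le (hnonneg k))

theorem VoltageFeasible.combo (hW : 𝒩.VoltageFeasible Λ W) (hW' : 𝒩.VoltageFeasible Λ' W')
    {a b : ℝ} (ha : 0 ≤ a) (hb : 0 ≤ b) (hab : a + b = 1) :
    𝒩.VoltageFeasible (a • Λ + b • Λ') (W.combo a b W') := by
  have hflow := hW.isFlow.combo hW'.isFlow hab
  refine ⟨hflow.feeder, fun k => ?_, fun k => ?_, fun k => ?_, fun k => ?_⟩
  · have hoff := hflow.off_eq k
    rw [← hflow.current_eq, lineDrop_current] at hoff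
    linarith
  · exact convex_Ici (𝒩.vlo k) (hW.lower k) (hW'.lower k) ha hb hab
  · exact convex_Iic (𝒩.vhi k) (hW.upper k) (hW'.upper k) ha hb hab
  · rw [edgeMatrix_combo]
    exact ((hW.psd k).smul ha).add ((hW'.psd k).smul hb)

end PowerFlow

section FeasibleLoads

variable {N T : Type*} [Fintype N] [Fintype T] {𝒩 : Network N T}

/-- The pairs of loads and voltage variables (the latter split into diagonal and off-diagonal part)
that satisfy the load limits and the relaxed voltage constraints. -/
def flowSet (𝒩 : Network N T) : Set ((N → T → ℝ) × (Option N → ℝ) × (N → ℝ)) :=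
  {x | (0 ≤ x.1 ∧ ∀ i, ∑ j, x.1 i j ≤ 𝒩.M i) ∧ 𝒩.VoltageFeasible x.1 ⟨x.2.1, x.2.2⟩}

/-- The nonnegative loads that satisfy the load limits and the relaxed voltage constraints. -/
def loadSet (𝒩 : Network N T) : Set (N → T → ℝ) := Prod.fst '' 𝒩.flowSet

theorem mem_loadSet {Λ : N → T → ℝ} :
    Λ ∈ 𝒩.loadSet ↔ (0 ≤ Λ ∧ ∀ i, ∑ j, Λ i j ≤ 𝒩.M i) ∧ ∃ W, 𝒩.VoltageFeasible Λ W := by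
  constructor
  · rintro ⟨x, ⟨hload, hW⟩, rfl⟩
    exact ⟨hload, _, hW⟩
  · rintro ⟨hload, W, hW⟩
    exact ⟨(Λ, W.diag, W.off), ⟨hload, hW⟩, rfl⟩

theorem convex_flowSet (𝒩 : Network N T) : Convex ℝ 𝒩.flowSet := by
  rintro x ⟨⟨hx, hxM⟩, hxW⟩ y ⟨⟨hy, hyM⟩, hyW⟩ a b ha hb hab
  refine ⟨⟨convex_Ici (0 : N → T → ℝ) hx hy ha hb hab, fun i => ?_⟩, hxW.combo hyW ha hb hab⟩
  have hsum : ∑ j, (a • x + b • y).1 i j = a • ∑ j, x.1 i j + b • ∑ j, y.1 i j := by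
    simp [Finset.sum_add_distrib, Finset.mul_sum]
  exact hsum.trans_le (convex_Iic (𝒩.M i) (hxM i) (hyM i) ha hb hab)

theorem convex_loadSet (𝒩 : Network N T) : Convex ℝ 𝒩.loadSet :=
  𝒩.convex_flowSet.linear_image (LinearMap.fst ℝ _ _)

theorem isClosed_setOf_voltageFeasible (𝒩 : Network N T) :
    IsClosed {x : (N → T → ℝ) × (Option N → ℝ) × (N → ℝ) |
      𝒩.VoltageFeasible x.1 ⟨x.2.1, x.2.2⟩} := by
  have hiff : ∀ (Λ : N → T → ℝ) (W : WVar N), 𝒩.VoltageFeasible Λ W ↔ W.diag none = 𝒩.V₀ ^ 2 ∧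
      ∀ k, (W.off k - W.diag (some k) - 𝒩.powerP Λ W k * 𝒩.R k - 𝒩.powerQ W k * 𝒩.X k = 0 ∧
        𝒩.vlo k ≤ W.diag (some k) ∧ W.diag (some k) ≤ 𝒩.vhi k) ∧
        0 ≤ W.diag (𝒩.parent k) ∧ 0 ≤ W.diag (some k) ∧
          W.off k ^ 2 ≤ W.diag (𝒩.parent k) * W.diag (some k) := fun Λ W =>
    ⟨fun hW => ⟨hW.feeder, fun k =>
      ⟨⟨hW.kirchhoff k, hW.lower k, hW.upper k⟩, posSemidef_two_iff.1 (hW.psd k)⟩⟩,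
    fun hW => ⟨hW.1, fun k => (hW.2 k).1.1, fun k => (hW.2 k).1.2.1, fun k => (hW.2 k).1.2.2,
      fun k => posSemidef_two_iff.2 (hW.2 k).2⟩⟩
  simp only [hiff, powerP, powerQ, lossP, lossQ, ofPred_and, ofPred_forall]
  refine (isClosed_eq (by fun_prop) (by fun_prop)).inter (isClosed_iInter fun k => .inter
    (.inter (isClosed_eq ?_ ?_) (.inter (isClosed_le ?_ ?_) (isClosed_le ?_ ?_)))
    (.inter (isClosed_le ?_ ?_) (.inter (isClosed_le ?_ ?_) (isClosed_le ?_ ?_))))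
  all_goals fun_prop

theorem isClosed_flowSet (𝒩 : Network N T) : IsClosed 𝒩.flowSet := by
  simp only [flowSet, ofPred_and, ofPred_forall]
  exact .inter (.inter (isClosed_le continuous_const continuous_fst)
    (isClosed_iInter fun i => isClosed_le (by fun_prop) continuous_const))
    𝒩.isClosed_setOf_voltageFeasible

theorem VoltageFeasible.diag_mem_Icc {Λ : N → T → ℝ} {W : WVar N} (hW : 𝒩.VoltageFeasible Λ W)
    (h : 𝒩.Standing) (o : Option N) : W.diag o ∈ Icc 0 (𝒩.V₀ ^ 2 + ∑ k, 𝒩.vhi k) := by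
  have hvhi : ∀ k, 0 ≤ 𝒩.vhi k := fun k => (sq_nonneg _).trans (h.le_vhi k)
  rcases o with _ | k
  · rw [hW.feeder]
    exact ⟨sq_nonneg _, le_add_of_nonneg_right (Finset.sum_nonneg fun k _ => hvhi k)⟩
  · refine ⟨(hW.diag_pos h k).le, (hW.upper k).trans ?_⟩
    exact (Finset.single_le_sum (fun k _ => hvhi k) (Finset.mem_univ k)).trans
      (le_add_of_nonneg_left (sq_nonneg _))

theorem VoltageFeasible.off_mem_Icc {Λ : N → T → ℝ} {W : WVar N} (hW : 𝒩.VoltageFeasible Λ W)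
    (h : 𝒩.Standing) (k : N) :
    W.off k ∈ Icc (-(𝒩.V₀ ^ 2 + ∑ k, 𝒩.vhi k)) (𝒩.V₀ ^ 2 + ∑ k, 𝒩.vhi k) := by
  have hp := hW.diag_mem_Icc h (𝒩.parent k)
  have hk := hW.diag_mem_Icc h (some k)
  have hsq := (posSemidef_two_iff.1 (hW.psd k)).2.2
  refine abs_le.1 (abs_le_of_sq_le_sq (hsq.trans ?_) (hp.1.trans hp.2))
  rw [sq]
  exact mul_le_mul hp.2 hk.2 hk.1 (hp.1.trans hp.2)

theorem Standing.isCompact_flowSet (h : 𝒩.Standing) : IsCompact 𝒩.flowSet := by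
  set b : ℝ := 𝒩.V₀ ^ 2 + ∑ k, 𝒩.vhi k
  have hbox : IsCompact (Icc (0 : N → T → ℝ) (fun i _ => 𝒩.M i) ×ˢ
      (Icc (0 : Option N → ℝ) (fun _ => b) ×ˢ Icc (fun _ : N => -b) (fun _ => b))) :=
    isCompact_Icc.prod (isCompact_Icc.prod isCompact_Icc)
  refine hbox.of_isClosed_subset 𝒩.isClosed_flowSet fun x hx => ?_
  obtain ⟨⟨hpos, hM⟩, hW⟩ := hx
  have hload : ∀ i j, x.1 i j ≤ 𝒩.M i := fun i j =>
    (Finset.single_le_sum (fun j _ => hpos i j) (Finset.mem_univ j)).trans (hM i)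
  exact ⟨⟨hpos, hload⟩, ⟨fun o => (hW.diag_mem_Icc h o).1, fun o => (hW.diag_mem_Icc h o).2⟩,
    fun k => (hW.off_mem_Icc h k).1, fun k => (hW.off_mem_Icc h k).2⟩

theorem Standing.isCompact_loadSet (h : 𝒩.Standing) : IsCompact 𝒩.loadSet :=
  h.isCompact_flowSet.image continuous_fst

theorem Standing.exists_minimal_current (h : 𝒩.Standing) {Λ : N → T → ℝ} (hΛ : Λ ∈ 𝒩.loadSet) :
    ∃ W, 𝒩.VoltageFeasible Λ W ∧
      ∀ W', 𝒩.VoltageFeasible Λ W' → ∑ k, 𝒩.current W k ≤ ∑ k, 𝒩.current W' k := by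
  obtain ⟨hload, W₀, hW₀⟩ := mem_loadSet.1 hΛ
  have hK : IsCompact (𝒩.flowSet ∩ Prod.fst ⁻¹' {Λ}) :=
    h.isCompact_flowSet.inter_right (isClosed_singleton.preimage continuous_fst)
  obtain ⟨⟨Λ', d, o⟩, ⟨⟨-, hW⟩, rfl⟩, hmin⟩ := hK.exists_isMinOn
    ⟨(Λ, W₀.diag, W₀.off), ⟨hload, hW₀⟩, rfl⟩
    (f := fun x => ∑ k, 𝒩.current ⟨x.2.1, x.2.2⟩ k) (by unfold current; fun_prop)
  exact ⟨⟨d, o⟩, hW, fun W' hW' =>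
    hmin (show (Λ', W'.diag, W'.off) ∈ _ from ⟨⟨hload, hW'⟩, rfl⟩)⟩

-- Exactness of the relaxation: when the total squared current is minimal, no edge current can be
-- lowered to its tight value, and a tight edge matrix has determinant `0`.
theorem Standing.exists_rank_eq_one (h : 𝒩.Standing) {Λ : N → T → ℝ} (hΛ : Λ ∈ 𝒩.loadSet) :
    ∃ W, 𝒩.VoltageFeasible Λ W ∧ ∀ k, (𝒩.edgeMatrix W k).rank = 1 := by
  obtain ⟨W, hW, hmin⟩ := h.exists_minimal_current hΛ
  obtain ⟨W', hW', hcur⟩ := hW.exists_current_eq_tightCurrent h (mem_loadSet.1 hΛ).1.1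
  have htight : ∀ k, 𝒩.tightCurrent Λ W k = 𝒩.current W k := fun k =>
    (Finset.sum_eq_sum_iff_of_le fun k _ => hW.tightCurrent_le h k).1
      (le_antisymm (Finset.sum_le_sum fun k _ => hW.tightCurrent_le h k)
        ((hmin W' hW').trans_eq (by rw [hcur]))) k (Finset.mem_univ k)
  refine ⟨W, hW, fun k => rank_two_eq_one (hW.diag_pos h k) ?_⟩
  have hsq := hW.sq_lineDrop_eq h k
  rw [htight k] at hsq
  rw [hW.isFlow.diag_parent_eq h k, hW.isFlow.off_eq k]
  linear_combination hsq

-- The flow with loads `ε • Λ` and squared currents `ε` interpolates between the flow without loads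
-- and the one with loads `Λ` and currents `1`; its line drops are of order `ε`, so that their
-- squares are dominated by the currents.
theorem Standing.eventually_smul_mem_loadSet (h : 𝒩.Standing) {Λ : N → T → ℝ} (hΛ : 0 ≤ Λ) :
    ∀ᶠ ε in 𝓝[>] (0 : ℝ), ε • Λ ∈ 𝒩.loadSet := by
  obtain ⟨W, hW⟩ := h.exists_isFlow Λ 1
  have eventually_lt {f : ℝ → ℝ} {m : ℝ} (hf : Continuous f) (h0 : f 0 < m) :
      ∀ᶠ ε in 𝓝[>] 0, f ε < m :=
    ((hf.tendsto 0).eventually_lt_const h0).filter_mono nhdsWithin_le_nhds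
  have hM : ∀ᶠ ε in 𝓝[>] (0 : ℝ), ∀ i, ∑ j, ε * Λ i j < 𝒩.M i :=
    eventually_all.2 fun i => eventually_lt (by fun_prop) (by simpa using h.M_pos i)
  have hlow : ∀ᶠ ε in 𝓝[>] (0 : ℝ), ∀ k,
      -((1 - ε) * 𝒩.V₀ ^ 2 + ε * W.diag (some k)) < -𝒩.vlo k :=
    eventually_all.2 fun k => eventually_lt (by fun_prop) (by simpa using h.vlo_lt k)
  have hsq : ∀ᶠ ε in 𝓝[>] (0 : ℝ), ∀ k, ε * 𝒩.lineDrop Λ 1 k ^ 2 < 𝒩.impSq k * 𝒩.vlo k :=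
    eventually_all.2 fun k => eventually_lt (by fun_prop)
      (by simpa using mul_pos (h.impSq_pos k) (h.vlo_pos k))
  filter_upwards [hM, hlow, hsq, self_mem_nhdsWithin] with ε hMε hlowε hsqε hε
  have hε : 0 < ε := hε
  have hflow := 𝒩.isFlow_zero.combo hW (sub_add_cancel 1 ε)
  simp only [smul_zero, zero_add] at hflow
  have hεΛ : 0 ≤ ε • Λ := smul_nonneg hε.le hΛ
  have hlow' : ∀ k, 𝒩.vlo k ≤ (1 - ε) * 𝒩.V₀ ^ 2 + ε * W.diag (some k) := fun k =>
    (neg_lt_neg_iff.1 (hlowε k)).le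
  refine mem_loadSet.2 ⟨⟨hεΛ, fun i => (hMε i).le⟩, _,
    hflow.voltageFeasible h hεΛ (smul_nonneg hε.le zero_le_one) hlow' fun k => ?_⟩
  rw [lineDrop_smul]
  calc (ε • 𝒩.lineDrop Λ 1) k ^ 2 = ε * (ε * 𝒩.lineDrop Λ 1 k ^ 2) := by
        simp only [Pi.smul_apply, smul_eq_mul]; ring
    _ ≤ ε * (𝒩.impSq k * 𝒩.vlo k) := mul_le_mul_of_nonneg_left (hsqε k).le hε.le
    _ ≤ ε * (𝒩.impSq k * ((1 - ε) * 𝒩.V₀ ^ 2 + ε * W.diag (some k))) := by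
        gcongr
        exacts [(h.impSq_pos k).le, hlow' k]
    _ = 𝒩.impSq k * (ε • (1 : N → ℝ)) k * ((1 - ε) * 𝒩.V₀ ^ 2 + ε * W.diag (some k)) := by
        simp only [Pi.smul_apply, Pi.one_apply, smul_eq_mul]; ring

end FeasibleLoads

end Network

namespace IsUtility

variable {u : ℝ → EReal}

theorem coe_toReal (hu : IsUtility u) {x : ℝ} (hx : 0 < x) : ((u x).toReal : EReal) = u x :=
  EReal.coe_toReal (hu.finite x hx).2 (hu.finite x hx).1

theorem strictConcaveOn_toReal (hu : IsUtility u) :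
    StrictConcaveOn ℝ (Ioi 0) (fun x => (u x).toReal) := by
  refine ⟨convex_Ioi 0, fun x hx y hy hne a b ha hb hab => ?_⟩
  have hm : 0 < a * x + b * y := add_pos (mul_pos ha hx) (mul_pos hb hy)
  have h := hu.strictConcave x (mem_Ici_of_Ioi hx) y (mem_Ici_of_Ioi hy) hne a b ha hb hab
  rwa [← hu.coe_toReal hx, ← hu.coe_toReal hy, ← hu.coe_toReal hm, ← EReal.coe_mul,
    ← EReal.coe_mul, ← EReal.coe_add, EReal.coe_lt_coe_iff] at h

theorem strictAntiOn_derivE (hu : IsUtility u) : StrictAntiOn (derivE u) (Ioi 0) :=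
  hu.strictConcaveOn_toReal.strictAntiOn_deriv fun x hx => hu.diff x hx

theorem derivE_pos (hu : IsUtility u) {x : ℝ} (hx : 0 < x) : 0 < derivE u x := by
  have hx1 : x < x + 1 := lt_add_one x
  have hlt : (u x).toReal < (u (x + 1)).toReal := by
    rw [← EReal.coe_lt_coe_iff, hu.coe_toReal hx, hu.coe_toReal (hx.trans hx1)]
    exact hu.strictMono hx.le (hx.trans hx1).le hx1
  have hslope := hu.strictConcaveOn_toReal.slope_lt_deriv hx (hx.trans hx1) hx1 (hu.diff x hx)
  refine lt_trans ?_ hslope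
  rw [slope_def_field]
  exact div_pos (sub_pos.2 hlt) (sub_pos.2 hx1)

theorem continuousOn_derivE (hu : IsUtility u) : ContinuousOn (derivE u) (Ioi 0) :=
  fun x hx => (hu.diff₂ x hx).continuousAt.continuousWithinAt

theorem isMarginal (hu : IsUtility u) {c : ℝ} (hc : 0 < c) : IsMarginal c u (derivE u) :=
  have hsub : Ioc 0 c ⊆ Ioi 0 := Ioc_subset_Ioi_self
  IsMarginal.of_hasDerivAt hc (fun x hx => hu.finite x hx.1)
    (fun _ hx => (hu.strictMono self_mem_Ici hx.1.le hx.1).le)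
    (fun x hx => (hu.diff x hx.1).continuousAt.continuousWithinAt)
    (fun x hx => (hu.diff x hx.1).hasDerivAt) (hu.strictAntiOn_derivE.mono hsub)
    (hu.continuousOn_derivE.mono hsub) (fun _ hx => (hu.derivE_pos hx.1).le) hu.slope

end IsUtility

namespace Network

variable {N T : Type*} [Fintype N] [Fintype T] {𝒩 : Network N T} {z : N → T → ℝ}

/-- The charging rates that are feasible in state `z`, as a subset of `N × T → ℝ`; the rank
condition on the edge matrices is dropped, which is harmless by `Standing.rateFeasible_iff`. -/
def rateSet (𝒩 : Network N T) (z : N → T → ℝ) : Set (N × T → ℝ) :=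
  {p | (∀ x, p x ∈ Icc 0 (𝒩.cmax x.2)) ∧ (fun i j => z i j * p (i, j)) ∈ 𝒩.loadSet}

theorem Standing.rateFeasible_iff (h : 𝒩.Standing) (hz : 0 ≤ z) {p : N → T → ℝ} :
    𝒩.RateFeasible z p ↔ (fun x => p x.1 x.2) ∈ 𝒩.rateSet z := by
  constructor
  · intro hp
    obtain ⟨W, hW, -⟩ := hp.voltage
    exact ⟨fun x => ⟨hp.nonneg _ _, hp.le_cmax _ _⟩, mem_loadSet.2
      ⟨⟨fun i j => mul_nonneg (hz i j) (hp.nonneg i j), hp.load⟩, W, hW⟩⟩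
  · rintro ⟨hbox, hload⟩
    exact ⟨(mem_loadSet.1 hload).1.2, fun i j => (hbox (i, j)).1, fun i j => (hbox (i, j)).2,
      h.exists_rank_eq_one hload⟩

theorem convex_rateSet (𝒩 : Network N T) (z : N → T → ℝ) : Convex ℝ (𝒩.rateSet z) := by
  rintro p ⟨hp, hpl⟩ p' ⟨hp', hpl'⟩ a b ha hb hab
  refine ⟨fun x => convex_Icc _ _ (hp x) (hp' x) ha hb hab, ?_⟩
  convert 𝒩.convex_loadSet hpl hpl' ha hb hab using 1
  ext i j
  simp only [Pi.add_apply, Pi.smul_apply, smul_eq_mul]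
  ring

theorem Standing.isCompact_rateSet (h : 𝒩.Standing) (z : N → T → ℝ) :
    IsCompact (𝒩.rateSet z) := by
  have hcont : Continuous fun (p : N × T → ℝ) i j => z i j * p (i, j) := by fun_prop
  convert (isCompact_univ_pi fun x : N × T => isCompact_Icc (a := 0) (b := 𝒩.cmax x.2)).inter_right
    (h.isCompact_loadSet.isClosed.preimage hcont) using 1
  ext p
  exact and_congr_left fun _ => mem_univ_pi.symm

theorem Standing.exists_pos_mem_rateSet (h : 𝒩.Standing) (hz : 0 ≤ z) :
    ∃ p ∈ 𝒩.rateSet z, ∀ x, 0 < p x := by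
  have hcmax : ∀ᶠ ε in 𝓝[>] (0 : ℝ), ∀ j, ε < 𝒩.cmax j :=
    eventually_all.2 fun j => eventually_nhdsWithin_of_eventually_nhds
      (eventually_lt_nhds (h.cmax_pos j))
  obtain ⟨ε, hload, hle, hε : 0 < ε⟩ :=
    ((h.eventually_smul_mem_loadSet hz).and (hcmax.and self_mem_nhdsWithin)).exists
  refine ⟨fun _ => ε, ⟨fun x => ⟨hε.le, (hle x.2).le⟩, ?_⟩, fun _ => hε⟩
  convert hload using 3
  exact mul_comm _ _

theorem mem_rateSet_congr {p p' : N × T → ℝ} (hp : p ∈ 𝒩.rateSet z)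
    (hbox : ∀ x, p' x ∈ Icc 0 (𝒩.cmax x.2)) (heq : ∀ x, z x.1 x.2 ≠ 0 → p' x = p x) :
    p' ∈ 𝒩.rateSet z := by
  refine ⟨hbox, ?_⟩
  convert hp.2 using 3 with i j
  by_cases hij : z i j = 0
  · simp [hij]
  · rw [heq (i, j) hij]

theorem rateObjective_eq_sum_prod (𝒩 : Network N T) (z p : N → T → ℝ) :
    𝒩.rateObjective z p = ∑ x : N × T, (z x.1 x.2 : EReal) * 𝒩.u x.1 x.2 (p x.1 x.2) := by
  rw [rateObjective, Fintype.sum_prod_type]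

/-- The weights of the charging problem, with `0` replaced by `1`. Where `z` vanishes, the rate
contributes neither to the load nor to the objective, so that a positive weight may be used there
to make the objective strictly concave in every coordinate. -/
def posWeight (z : N → T → ℝ) (x : N × T) : ℝ :=
  if z x.1 x.2 = 0 then 1 else z x.1 x.2

omit [Fintype N] [Fintype T] in
theorem posWeight_pos (hz : 0 ≤ z) (x : N × T) : 0 < posWeight z x := by
  unfold posWeight
  split_ifs with hx
  · exact one_pos
  · exact (hz x.1 x.2).lt_of_ne' hx

theorem sum_posWeight_mul {p : N → T → ℝ} {m y : N × T → ℝ}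
    (hzero : ∀ x, z x.1 x.2 = 0 → y x = m x) (hne : ∀ x, z x.1 x.2 ≠ 0 → y x = p x.1 x.2) :
    ∑ x, (posWeight z x : EReal) * 𝒩.u x.1 x.2 (y x)
      = ∑ x with z x.1 x.2 = 0, 𝒩.u x.1 x.2 (m x) + 𝒩.rateObjective z p := by
  rw [rateObjective_eq_sum_prod, Finset.sum_filter, ← Finset.sum_add_distrib]
  refine Finset.sum_congr rfl fun x _ => ?_
  by_cases hx : z x.1 x.2 = 0
  · simp [posWeight, hx, hzero x hx]
  · simp [posWeight, hx, hne x hx]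

theorem Standing.isChargingRate_of_posWeight (h : 𝒩.Standing) (hz : 0 ≤ z) {m : N × T → ℝ}
    (hm : m ∈ 𝒩.rateSet z) (hpos : ∀ x, 0 < m x)
    (hmax : ∀ y ∈ 𝒩.rateSet z, ∑ x, (posWeight z x : EReal) * 𝒩.u x.1 x.2 (y x)
      ≤ ∑ x, (posWeight z x : EReal) * 𝒩.u x.1 x.2 (m x)) :
    𝒩.IsChargingRate z (fun i j => if z i j = 0 then 0 else m (i, j)) where
  feasible := by
    refine (h.rateFeasible_iff hz).2 (mem_rateSet_congr hm (fun x => ?_) fun x hx => if_neg hx)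
    split_ifs
    · exact ⟨le_rfl, (h.cmax_pos _).le⟩
    · exact hm.1 x
  zero i j hij := if_pos hij
  optimal p hp := by
    have hmem : (fun x => if z x.1 x.2 = 0 then m x else p x.1 x.2) ∈ 𝒩.rateSet z := by
      rw [h.rateFeasible_iff hz] at hp
      refine mem_rateSet_congr hp (fun x => ?_) fun x hx => if_neg hx
      split_ifs
      exacts [hm.1 x, hp.1 x]
    have hle := hmax _ hmem
    rw [sum_posWeight_mul (p := p) (m := m) (fun x hx => if_pos hx) fun x hx => if_neg hx,
      sum_posWeight_mul (m := m) (p := fun i j => if z i j = 0 then 0 else m (i, j))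
        (fun _ _ => rfl) fun x hx => (if_neg hx).symm,
      Finset.sum_congr rfl fun x _ => ((h.utility x.1 x.2).coe_toReal (hpos x)).symm,
      ← ereal_coe_sum] at hle
    exact (EReal.addLECancellable_coe _).add_le_add_iff_left.1 hle

theorem Standing.exists_isChargingRate (h : 𝒩.Standing) (hz : 0 ≤ z) :
    ∃ p, 𝒩.IsChargingRate z p := by
  obtain ⟨e, heC, he⟩ := h.exists_pos_mem_rateSet hz
  obtain ⟨m, hmC, hpos, -, hstrict⟩ := exists_strict_maximizer
    (fun x : N × T => ((h.utility x.1 x.2).isMarginal (h.cmax_pos x.2)).const_mul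
      (posWeight_pos hz x)) (𝒩.convex_rateSet z) (h.isCompact_rateSet z) (fun p hp => hp.1) heC he
  refine ⟨_, h.isChargingRate_of_posWeight hz hmC hpos fun y hy => ?_⟩
  obtain rfl | hne := eq_or_ne y m
  exacts [le_rfl, (hstrict y hy hne).le]

theorem Standing.isChargingRate_rate (h : 𝒩.Standing) (hz : 0 ≤ z) :
    𝒩.IsChargingRate z (𝒩.rate z) :=
  Classical.epsilon_spec (h.exists_isChargingRate hz)

omit [Fintype N] [Fintype T] in
theorem Standing.isMarginal_mul_utility (h : 𝒩.Standing) (hz : ∀ i j, 0 < z i j) (x : N × T) :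
    IsMarginal (𝒩.cmax x.2) (fun y => (z x.1 x.2 : EReal) * 𝒩.u x.1 x.2 y)
      (fun y => z x.1 x.2 * derivE (𝒩.u x.1 x.2) y) :=
  ((h.utility x.1 x.2).isMarginal (h.cmax_pos x.2)).const_mul (hz _ _)

theorem IsChargingRate.eq_of_firstOrder {p p' : N → T → ℝ} (hp' : 𝒩.IsChargingRate z p')
    (h : 𝒩.Standing) (hz : ∀ i j, 0 < z i j)
    (hp : (fun x => p x.1 x.2) ∈ 𝒩.rateSet z) (hpos : ∀ i j, 0 < p i j)
    (hfo : ∀ y ∈ 𝒩.rateSet z, ∑ x : N × T,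
      z x.1 x.2 * derivE (𝒩.u x.1 x.2) (p x.1 x.2) * (y x - p x.1 x.2) ≤ 0) : p' = p := by
  have hz' : 0 ≤ z := fun i j => (hz i j).le
  have hp'C := (h.rateFeasible_iff hz').1 hp'.feasible
  by_contra hne
  have hne' : (fun x : N × T => p' x.1 x.2) ≠ fun x => p x.1 x.2 :=
    fun heq => hne (funext₂ fun i j => congrFun heq (i, j))
  have hlt := sum_lt_of_firstOrder (h.isMarginal_mul_utility hz)
    (fun x => ⟨hpos _ _, (hp.1 x).2⟩) hp'C.1 hne' (hfo _ hp'C)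
  have hle := hp'.optimal p ((h.rateFeasible_iff hz').2 hp)
  rw [rateObjective_eq_sum_prod, rateObjective_eq_sum_prod] at hle
  exact hlt.not_ge hle

theorem Standing.rate_eq_iff_firstOrder (h : 𝒩.Standing) (hz : ∀ i j, 0 < z i j)
    {p : N → T → ℝ} :
    𝒩.rate z = p ↔ (fun x => p x.1 x.2) ∈ 𝒩.rateSet z ∧ (∀ i j, 0 < p i j) ∧
      ∀ p' ∈ 𝒩.rateSet z, ∑ x : N × T,
        z x.1 x.2 * derivE (𝒩.u x.1 x.2) (p x.1 x.2) * (p' x - p x.1 x.2) ≤ 0 := by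
  have hz' : 0 ≤ z := fun i j => (hz i j).le
  have hrate := h.isChargingRate_rate hz'
  constructor
  · rintro rfl
    obtain ⟨e, heC, he⟩ := h.exists_pos_mem_rateSet hz'
    obtain ⟨m, hmC, hm, hfo, -⟩ := exists_strict_maximizer (h.isMarginal_mul_utility hz)
      (𝒩.convex_rateSet z) (h.isCompact_rateSet z) (fun p hp => hp.1) heC he
    have hrate_eq : 𝒩.rate z = fun i j => m (i, j) :=
      hrate.eq_of_firstOrder h hz hmC (fun i j => hm (i, j)) hfo
    rw [hrate_eq]
    exact ⟨hmC, fun i j => hm (i, j), hfo⟩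
  · rintro ⟨hp, hpos, hfo⟩
    exact hrate.eq_of_firstOrder h hz hp hpos hfo

end Network

section Calculus

theorem continuousOn_invFunOn_of_isCompact {X Y : Type*} [TopologicalSpace X] [Nonempty X]
    [TopologicalSpace Y] [T2Space Y] {f : X → Y} {s : Set X} (hs : IsCompact s)
    (hf : ContinuousOn f s) (hinj : InjOn f s) :
    ContinuousOn (Function.invFunOn f s) (f '' s) := by
  refine continuousOn_iff_isClosed.2 fun t ht => ⟨f '' (t ∩ s),
    ((hs.inter_left ht).image_of_continuousOn (hf.mono inter_subset_right)).isClosed, ?_⟩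
  ext y
  constructor
  · rintro ⟨hyt, hy⟩
    exact ⟨⟨_, ⟨hyt, Function.invFunOn_mem hy⟩, Function.invFunOn_eq hy⟩, hy⟩
  · rintro ⟨⟨x, ⟨hxt, hxs⟩, rfl⟩, hy⟩
    exact ⟨by rwa [mem_preimage, hinj.leftInvOn_invFunOn hxs], hy⟩

theorem exists_hasDerivAt_of_continuousOn_Ioi {E : Type*} [NormedAddCommGroup E]
    [NormedSpace ℝ E] [CompleteSpace E] {a : ℝ} {f : ℝ → E} (hf : ContinuousOn f (Ioi a)) :
    ∃ F : ℝ → E, ∀ x ∈ Ioi a, HasDerivAt F (f x) x := by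
  refine ⟨fun x => ∫ s in (a + 1)..x, f s, fun x hx => ?_⟩
  have hsub : uIcc (a + 1) x ⊆ Ioi a := ordConnected_Ioi.uIcc_subset (lt_add_one a) hx
  exact intervalIntegral.integral_hasDerivAt_right (hf.mono hsub).intervalIntegrable
    (hf.stronglyMeasurableAtFilter isOpen_Ioi x hx) (hf.continuousAt (Ioi_mem_nhds hx))

theorem exists_continuousOn_Icc_eq_coe {a c : ℝ} (hac : a < c) {F : ℝ → ℝ}
    (hF : ContinuousOn F (Ioc a c)) (hmono : MonotoneOn F (Ioo a c)) :
    ∃ G : ℝ → EReal, ContinuousOn G (Icc a c) ∧ ∀ x, x ≠ a → G x = F x := by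
  refine ⟨Function.update (fun x => (F x : EReal)) a
    (sInf ((fun x => (F x : EReal)) '' Ioo a c)), ?_, fun x hx => Function.update_of_ne hx _ _⟩
  rw [continuousOn_update_iff, Icc_sdiff_left, nhdsWithin_Ioc_eq_nhdsGT hac]
  exact ⟨continuous_coe_real_ereal.comp_continuousOn hF, fun _ =>
    MonotoneOn.tendsto_nhdsWithin_Ioo_right (nonempty_Ioo.2 hac)
      (fun x hx y hy hxy => EReal.coe_le_coe_iff.2 (hmono hx hy hxy)) (OrderBot.bddBelow _)⟩

theorem monotoneOn_Ioc_of_hasDerivAt_nonneg {a c : ℝ} {f f' : ℝ → ℝ}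
    (hf : ContinuousOn f (Ioc a c)) (hd : ∀ x ∈ Ioo a c, HasDerivAt f (f' x) x)
    (hf' : ∀ x ∈ Ioo a c, 0 ≤ f' x) : MonotoneOn f (Ioc a c) := by
  refine monotoneOn_of_hasDerivWithinAt_nonneg (f' := f') (convex_Ioc a c) hf ?_ ?_ <;>
    rw [interior_Ioc]
  exacts [fun x hx => (hd x hx).hasDerivWithinAt, hf']

-- The value at `a` of the primitive is its limit there, which may be `-∞`.
theorem exists_ereal_primitive_Icc {a c : ℝ} (hac : a < c) {ψ : ℝ → ℝ}
    (hψ : ContinuousOn ψ (Ioc a c)) (hpos : ∀ x ∈ Ioc a c, 0 ≤ ψ x) :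
    ∃ G : ℝ → EReal, (∀ x ∈ Ioc a c, G x ≠ ⊥ ∧ G x ≠ ⊤) ∧ ContinuousOn G (Icc a c) ∧
      ∀ x ∈ Ioo a c, HasDerivAt (fun x => (G x).toReal) (ψ x) x := by
  have hψc : ContinuousOn (fun x => ψ (min x c)) (Ioi a) :=
    hψ.comp (by fun_prop) fun x hx => ⟨lt_min hx hac, min_le_right x c⟩
  obtain ⟨F, hF⟩ := exists_hasDerivAt_of_continuousOn_Ioi hψc
  have hFc : ContinuousOn F (Ioc a c) :=
    fun x hx => (hF x hx.1).continuousAt.continuousWithinAt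
  have hFmono : MonotoneOn F (Ioc a c) :=
    monotoneOn_Ioc_of_hasDerivAt_nonneg hFc (fun x hx => hF x hx.1) fun x hx =>
      hpos _ ⟨lt_min hx.1 hac, min_le_right x c⟩
  obtain ⟨G, hG, hGF⟩ := exists_continuousOn_Icc_eq_coe hac hFc (hFmono.mono Ioo_subset_Ioc_self)
  refine ⟨G, fun x hx => ?_, hG, fun x hx => ?_⟩
  · rw [hGF x hx.1.ne']
    exact ⟨EReal.coe_ne_bot _, EReal.coe_ne_top _⟩
  · have hFx := hF x hx.1
    rw [min_eq_left hx.2.le] at hFx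
    refine hFx.congr_of_eventuallyEq ?_
    filter_upwards [lt_mem_nhds hx.1] with y hy
    rw [hGF y (ne_of_gt hy), EReal.toReal_coe]

end Calculus

theorem integral_pos_of_ae_pos {α : Type*} [MeasurableSpace α] {μ : Measure α} [NeZero μ]
    {f : α → ℝ} (hf : Integrable f μ) (hpos : ∀ᵐ x ∂μ, 0 < f x) : 0 < ∫ x, f x ∂μ := by
  refine (integral_nonneg_of_ae (hpos.mono fun _ => le_of_lt)).lt_of_ne' fun h0 => ?_
  have hzero := (integral_eq_zero_iff_of_nonneg_ae (hpos.mono fun _ => le_of_lt) hf).1 h0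
  obtain ⟨x, hx0, hx⟩ := (hzero.and hpos).exists
  exact hx.ne' hx0

theorem le_leftmost {μ : Measure ℝ} [NeZero μ] {a : ℝ} (h : ∀ᵐ x ∂μ, a ≤ x) :
    a ≤ leftmost μ :=
  le_csInf (Measure.nonempty_support (NeZero.ne μ))
    (Measure.support_subset_of_isClosed isClosed_Ici h)

namespace Network

section Sojourn

variable {b d p : ℝ}

theorem sojourn_of_pos (hp : 0 < p) : sojourn b d p = min d (b / p) := if_neg hp.ne'

theorem sojourn_le : sojourn b d p ≤ d := by
  unfold sojourn
  split_ifs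
  exacts [le_rfl, min_le_left _ _]

theorem sojourn_pos (hb : 0 < b) (hd : 0 < d) (hp : 0 ≤ p) : 0 < sojourn b d p := by
  unfold sojourn
  split_ifs with hp0
  · exact hd
  · exact lt_min hd (div_pos hb (hp.lt_of_ne' hp0))

theorem sojourn_mul (hp : 0 < p) : sojourn b d p * p = min (d * p) b := by
  rw [sojourn_of_pos hp, min_mul_of_nonneg _ _ hp.le, div_mul_cancel₀ _ hp.ne']

theorem measurable_sojourn (p : ℝ) : Measurable fun x : ℝ × ℝ => sojourn x.1 x.2 p := by
  by_cases hp : p = 0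
  · simpa only [sojourn, hp, if_true] using measurable_snd
  · simp only [sojourn, hp, if_false]
    fun_prop

theorem norm_min_mul_le (hb : 0 ≤ b) (hd : 0 ≤ d) (hp : 0 ≤ p) : ‖min (d * p) b‖ ≤ d * p := by
  rw [Real.norm_of_nonneg (le_min (mul_nonneg hd hp) hb)]
  exact min_le_left _ _

variable {μ : Measure (ℝ × ℝ)}

theorem integrable_sojourn (hB : ∀ᵐ w ∂μ, 0 < w.1) (hD : ∀ᵐ w ∂μ, 0 < w.2)
    (hDi : Integrable (fun w => w.2) μ) (hp : 0 ≤ p) :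
    Integrable (fun w => sojourn w.1 w.2 p) μ := by
  refine hDi.mono' (measurable_sojourn p).aestronglyMeasurable ?_
  filter_upwards [hB, hD] with w hBw hDw
  rw [Real.norm_of_nonneg (sojourn_pos hBw hDw hp).le]
  exact sojourn_le

theorem integrable_min_mul (hB : ∀ᵐ w ∂μ, 0 < w.1) (hD : ∀ᵐ w ∂μ, 0 < w.2)
    (hDi : Integrable (fun w => w.2) μ) (hp : 0 ≤ p) :
    Integrable (fun w => min (w.2 * p) w.1) μ := by
  refine (hDi.mul_const p).mono' (by fun_prop) ?_
  filter_upwards [hB, hD] with w hBw hDw using norm_min_mul_le hBw.le hDw.le hp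

theorem integral_sojourn_pos [NeZero μ] (hB : ∀ᵐ w ∂μ, 0 < w.1) (hD : ∀ᵐ w ∂μ, 0 < w.2)
    (hDi : Integrable (fun w => w.2) μ) (hp : 0 ≤ p) : 0 < ∫ w, sojourn w.1 w.2 p ∂μ := by
  refine integral_pos_of_ae_pos (integrable_sojourn hB hD hDi hp) ?_
  filter_upwards [hB, hD] with w hBw hDw using sojourn_pos hBw hDw hp

theorem integral_sojourn_mul (hp : 0 < p) :
    (∫ w, sojourn w.1 w.2 p ∂μ) * p = ∫ w, min (w.2 * p) w.1 ∂μ := by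
  simp only [← integral_mul_const, sojourn_mul hp]

-- If the two integrals were equal, then `B ≤ D x` almost surely, so that `D / B` would be bounded
-- below by `1 / x > 1 / y`.
theorem integral_min_mul_lt [IsProbabilityMeasure μ] (hB : ∀ᵐ w ∂μ, 0 < w.1)
    (hD : ∀ᵐ w ∂μ, 0 < w.2) (hDi : Integrable (fun w => w.2) μ) {x y : ℝ} (hx : 0 ≤ x)
    (hxy : x < y) (hleft : leftmost (μ.map fun w => w.2 / w.1) ≤ 1 / y) :
    ∫ w, min (w.2 * x) w.1 ∂μ < ∫ w, min (w.2 * y) w.1 ∂μ := by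
  have hix := integrable_min_mul hB hD hDi hx
  have hiy := integrable_min_mul hB hD hDi (hx.trans hxy.le)
  have hle : (fun w : ℝ × ℝ => min (w.2 * x) w.1) ≤ᵐ[μ] fun w => min (w.2 * y) w.1 :=
    hD.mono fun w hw => min_le_min_right _ (mul_le_mul_of_nonneg_left hxy.le hw.le)
  refine (integral_mono_ae hix hiy hle).lt_of_ne fun heq => ?_
  have hBD : ∀ᵐ w ∂μ, 0 < w.1 ∧ w.1 ≤ w.2 * x := by
    filter_upwards [(integral_eq_iff_of_ae_le hix hiy hle).1 heq, hB, hD] with w hw hBw hDw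
    refine ⟨hBw, le_of_not_gt fun hlt => hw.not_lt ?_⟩
    rw [min_eq_left hlt.le]
    exact lt_min (mul_lt_mul_of_pos_left hxy hDw) hlt
  have hx0 : 0 < x := by
    obtain ⟨w, ⟨hBw, hBx⟩, hDw⟩ := (hBD.and hD).exists
    exact pos_of_mul_pos_right (hBw.trans_le hBx) hDw.le
  have hmeas : Measurable fun w : ℝ × ℝ => w.2 / w.1 := by fun_prop
  have := Measure.isProbabilityMeasure_map (μ := μ) hmeas.aemeasurable
  have hge : 1 / x ≤ leftmost (μ.map fun w => w.2 / w.1) := by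
    refine le_leftmost ((ae_map_iff hmeas.aemeasurable measurableSet_Ici).2 ?_)
    filter_upwards [hBD] with w hw
    rw [div_le_div_iff₀ hx0 hw.1, one_mul]
    exact hw.2
  exact (hge.trans hleft).not_gt (one_div_lt_one_div_of_lt hx0 hxy)

end Sojourn

variable {N T : Type*} {𝒩 : Network N T}

theorem Standing.meanD_pos (h : 𝒩.Standing) (j : T) : 0 < 𝒩.meanD j :=
  have := h.prob j
  integral_pos_of_ae_pos (h.D_integrable j) (h.D_pos j)

section LoadCurve

variable [Fintype T] {i : N} {j : T}

theorem Standing.lamTot_pos (h : 𝒩.Standing) (i : N) [Nonempty T] : 0 < 𝒩.lamTot i :=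
  Finset.sum_pos (fun j _ => h.lam_pos i j) Finset.univ_nonempty

theorem Standing.sum_lam_mul_meanD_pos (h : 𝒩.Standing) (i : N) [Nonempty T] :
    0 < ∑ j, 𝒩.lam i j * 𝒩.meanD j :=
  Finset.sum_pos (fun j _ => mul_pos (h.lam_pos i j) (h.meanD_pos j)) Finset.univ_nonempty

theorem Standing.gam_eq_lam_mul_min (h : 𝒩.Standing) (i : N) (j : T) :
    𝒩.gam i j = 𝒩.lam i j * min 1 (𝒩.K i / ∑ j', 𝒩.lam i j' * 𝒩.meanD j') := by
  have : Nonempty T := ⟨j⟩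
  have hlam := h.lamTot_pos i
  have hsum : ∑ j', 𝒩.lam i j' / 𝒩.lamTot i * 𝒩.meanD j'
      = (∑ j', 𝒩.lam i j' * 𝒩.meanD j') / 𝒩.lamTot i := by
    simp only [Finset.sum_div, div_mul_eq_mul_div]
  rw [gam, hsum, div_mul_eq_mul_div, mul_div_assoc, ← min_div_div_right hlam.le,
    div_self hlam.ne']
  congr 2
  field_simp

theorem Standing.gam_pos (h : 𝒩.Standing) (i : N) (j : T) : 0 < 𝒩.gam i j := by
  have : Nonempty T := ⟨j⟩
  rw [h.gam_eq_lam_mul_min i j]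
  exact mul_pos (h.lam_pos i j)
    (lt_min one_pos (div_pos (h.K_pos i) (h.sum_lam_mul_meanD_pos i)))

theorem Standing.g_zero (h : 𝒩.Standing) (i : N) (j : T) : 𝒩.g i j 0 = 0 := by
  have hzero : (fun w : ℝ × ℝ => min (w.2 * 0) w.1) =ᵐ[𝒩.F j] fun _ => 0 := by
    filter_upwards [h.B_pos j] with w hB
    rw [mul_zero, min_eq_left hB.le]
  rw [g, integral_congr_ae hzero, integral_zero, mul_zero]

theorem Standing.continuousOn_g (h : 𝒩.Standing) (i : N) (j : T) :
    ContinuousOn (𝒩.g i j) (Icc 0 (𝒩.cmax j)) := by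
  refine continuousOn_const.mul (continuousOn_of_dominated (bound := fun w => w.2 * 𝒩.cmax j)
    (fun x _ => by fun_prop) (fun x hx => ?_) ((h.D_integrable j).mul_const _)
    (Eventually.of_forall fun w => by fun_prop))
  filter_upwards [h.B_pos j, h.D_pos j] with w hB hD
  exact (norm_min_mul_le hB.le hD.le hx.1).trans (mul_le_mul_of_nonneg_left hx.2 hD.le)

/-- The condition `inf (D_j / B_j) ≤ 1 / c_j^max`: even at the maximal charging rate, some type-`j`
EVs leave before they are fully charged. -/
def ShortStay (𝒩 : Network N T) (j : T) : Prop :=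
  leftmost ((𝒩.F j).map (fun x => x.2 / x.1)) ≤ 1 / 𝒩.cmax j

theorem Standing.strictMonoOn_g (h : 𝒩.Standing) (hs : 𝒩.ShortStay j) (i : N) :
    StrictMonoOn (𝒩.g i j) (Icc 0 (𝒩.cmax j)) := fun _ hx _ hy hxy =>
  have := h.prob j
  mul_lt_mul_of_pos_left (integral_min_mul_lt (h.B_pos j) (h.D_pos j) (h.D_integrable j) hx.1 hxy
    (hs.trans (one_div_le_one_div_of_le (hx.1.trans_lt hxy) hy.2))) (h.gam_pos i j)

theorem Standing.g_cmax_pos (h : 𝒩.Standing) (hs : 𝒩.ShortStay j) (i : N) :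
    0 < 𝒩.g i j (𝒩.cmax j) := by
  have hc := h.cmax_pos j
  rw [← h.g_zero i j]
  exact h.strictMonoOn_g hs i ⟨le_rfl, hc.le⟩ ⟨hc.le, le_rfl⟩ hc

theorem Standing.image_g (h : 𝒩.Standing) (hs : 𝒩.ShortStay j) (i : N) :
    𝒩.g i j '' Icc 0 (𝒩.cmax j) = Icc 0 (𝒩.g i j (𝒩.cmax j)) := by
  have hc := (h.cmax_pos j).le
  have hmono := (h.strictMonoOn_g hs i).monotoneOn
  refine Subset.antisymm ?_ ?_
  · convert hmono.image_Icc_subset using 2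
    exact (h.g_zero i j).symm
  · simpa only [h.g_zero] using intermediate_value_Icc hc (h.continuousOn_g i j)

theorem Standing.gInv_mem (h : 𝒩.Standing) (hs : 𝒩.ShortStay j) {y : ℝ}
    (hy : y ∈ Icc 0 (𝒩.g i j (𝒩.cmax j))) : 𝒩.gInv i j y ∈ Icc 0 (𝒩.cmax j) :=
  Function.invFunOn_mem (h.image_g hs i ▸ hy :)

theorem Standing.g_gInv (h : 𝒩.Standing) (hs : 𝒩.ShortStay j) {y : ℝ}
    (hy : y ∈ Icc 0 (𝒩.g i j (𝒩.cmax j))) : 𝒩.g i j (𝒩.gInv i j y) = y :=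
  Function.invFunOn_eq (h.image_g hs i ▸ hy :)

theorem Standing.gInv_g (h : 𝒩.Standing) (hs : 𝒩.ShortStay j) {x : ℝ}
    (hx : x ∈ Icc 0 (𝒩.cmax j)) : 𝒩.gInv i j (𝒩.g i j x) = x :=
  (h.strictMonoOn_g hs i).injOn.leftInvOn_invFunOn hx

theorem Standing.gInv_zero (h : 𝒩.Standing) (hs : 𝒩.ShortStay j) (i : N) :
    𝒩.gInv i j 0 = 0 := by
  simpa only [h.g_zero] using h.gInv_g (i := i) hs ⟨le_rfl, (h.cmax_pos j).le⟩

theorem Standing.strictMonoOn_gInv (h : 𝒩.Standing) (hs : 𝒩.ShortStay j) (i : N) :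
    StrictMonoOn (𝒩.gInv i j) (Icc 0 (𝒩.g i j (𝒩.cmax j))) := fun x hx y hy hxy => by
  rwa [← (h.strictMonoOn_g hs i).lt_iff_lt (h.gInv_mem hs hx) (h.gInv_mem hs hy),
    h.g_gInv hs hx, h.g_gInv hs hy]

theorem Standing.continuousOn_gInv (h : 𝒩.Standing) (hs : 𝒩.ShortStay j) (i : N) :
    ContinuousOn (𝒩.gInv i j) (Icc 0 (𝒩.g i j (𝒩.cmax j))) := by
  rw [← h.image_g hs]
  exact continuousOn_invFunOn_of_isCompact isCompact_Icc (h.continuousOn_g i j)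
    (h.strictMonoOn_g hs i).injOn

theorem Standing.gInv_pos (h : 𝒩.Standing) (hs : 𝒩.ShortStay j) {y : ℝ}
    (hy : y ∈ Ioc 0 (𝒩.g i j (𝒩.cmax j))) : 0 < 𝒩.gInv i j y := by
  rw [← h.gInv_zero hs i]
  exact h.strictMonoOn_gInv hs i ⟨le_rfl, (h.g_cmax_pos hs i).le⟩ (Ioc_subset_Icc_self hy) hy.1

/-- The prescribed derivative `u_ij' ∘ g_ij⁻¹` of `G_ij`. -/
def marginal (𝒩 : Network N T) (i : N) (j : T) (y : ℝ) : ℝ := derivE (𝒩.u i j) (𝒩.gInv i j y)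

theorem Standing.continuousOn_marginal (h : 𝒩.Standing) (hs : 𝒩.ShortStay j) (i : N) :
    ContinuousOn (𝒩.marginal i j) (Ioc 0 (𝒩.g i j (𝒩.cmax j))) :=
  (h.utility i j).continuousOn_derivE.comp
    ((h.continuousOn_gInv hs i).mono Ioc_subset_Icc_self) fun _ hy => h.gInv_pos hs hy

theorem Standing.strictAntiOn_marginal (h : 𝒩.Standing) (hs : 𝒩.ShortStay j) (i : N) :
    StrictAntiOn (𝒩.marginal i j) (Ioc 0 (𝒩.g i j (𝒩.cmax j))) := fun _ hx _ hy hxy =>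
  (h.utility i j).strictAntiOn_derivE (h.gInv_pos hs hx) (h.gInv_pos hs hy)
    (h.strictMonoOn_gInv hs i (Ioc_subset_Icc_self hx) (Ioc_subset_Icc_self hy) hxy)

theorem Standing.marginal_pos (h : 𝒩.Standing) (hs : 𝒩.ShortStay j) {y : ℝ}
    (hy : y ∈ Ioc 0 (𝒩.g i j (𝒩.cmax j))) : 0 < 𝒩.marginal i j y :=
  (h.utility i j).derivE_pos (h.gInv_pos hs hy)

theorem Standing.tendsto_marginal (h : 𝒩.Standing) (hs : 𝒩.ShortStay j) (i : N) :
    Tendsto (𝒩.marginal i j) (𝓝[>] 0) atTop := by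
  have hg := h.g_cmax_pos hs i
  have hlim : Tendsto (𝒩.gInv i j) (𝓝[>] 0) (𝓝 0) := by
    have hcont := h.continuousOn_gInv hs i 0 ⟨le_rfl, hg.le⟩
    rw [ContinuousWithinAt, h.gInv_zero hs] at hcont
    rw [← nhdsWithin_Ioc_eq_nhdsGT hg]
    exact hcont.mono_left (nhdsWithin_mono _ Ioc_subset_Icc_self)
  refine (h.utility i j).slope.comp (tendsto_nhdsWithin_iff.2 ⟨hlim, ?_⟩)
  filter_upwards [Ioc_mem_nhdsGT hg] with y hy using h.gInv_pos hs hy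

theorem Standing.exists_isPrimitive (h : 𝒩.Standing) (hs : 𝒩.ShortStay j) (i : N) :
    ∃ G, 𝒩.IsPrimitive i j G :=
  have ⟨G, hfin, hcont, hderiv⟩ := exists_ereal_primitive_Icc (h.g_cmax_pos hs i)
    (h.continuousOn_marginal hs i) fun _ hy => (h.marginal_pos hs hy).le
  ⟨G, hfin, hcont, hderiv⟩

theorem IsPrimitive.continuousOn_toReal {G : ℝ → EReal} (hG : 𝒩.IsPrimitive i j G) :
    ContinuousOn (fun y => (G y).toReal) (Ioc 0 (𝒩.g i j (𝒩.cmax j))) :=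
  EReal.continuousOn_toReal.comp (hG.continuous.mono Ioc_subset_Icc_self) fun y hy => by
    simp [hG.finite y hy]

theorem IsPrimitive.zero_le {G : ℝ → EReal} (hG : 𝒩.IsPrimitive i j G) (h : 𝒩.Standing)
    (hs : 𝒩.ShortStay j) {y : ℝ} (hy : y ∈ Ioc 0 (𝒩.g i j (𝒩.cmax j))) : G 0 ≤ G y := by
  have hcoe : ∀ x ∈ Ioc 0 (𝒩.g i j (𝒩.cmax j)), ((G x).toReal : EReal) = G x := fun x hx =>
    EReal.coe_toReal (hG.finite x hx).2 (hG.finite x hx).1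
  have hmono : MonotoneOn (fun y => (G y).toReal) (Ioc 0 (𝒩.g i j (𝒩.cmax j))) :=
    monotoneOn_Ioc_of_hasDerivAt_nonneg hG.continuousOn_toReal hG.hasDeriv fun x hx =>
      (h.marginal_pos hs (Ioo_subset_Ioc_self hx)).le
  have hlim : Tendsto G (𝓝[>] 0) (𝓝 (G 0)) := by
    have hg := h.g_cmax_pos hs i
    rw [← nhdsWithin_Ioc_eq_nhdsGT hg]
    exact (hG.continuous 0 ⟨le_rfl, hg.le⟩).mono_left (nhdsWithin_mono _ Ioc_subset_Icc_self)
  refine le_of_tendsto hlim ?_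
  filter_upwards [Ioc_mem_nhdsGT hy.1] with x hx
  have hx' : x ∈ Ioc 0 (𝒩.g i j (𝒩.cmax j)) := ⟨hx.1, hx.2.trans hy.2⟩
  rw [← hcoe x hx', ← hcoe y hy, EReal.coe_le_coe_iff]
  exact hmono hx' hy hx.2

theorem IsPrimitive.isMarginal {G : ℝ → EReal} (hG : 𝒩.IsPrimitive i j G) (h : 𝒩.Standing)
    (hs : 𝒩.ShortStay j) : IsMarginal (𝒩.g i j (𝒩.cmax j)) G (𝒩.marginal i j) :=
  IsMarginal.of_hasDerivAt (h.g_cmax_pos hs i) hG.finite (fun _ hx => hG.zero_le h hs hx)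
    hG.continuousOn_toReal hG.hasDeriv (h.strictAntiOn_marginal hs i)
    (h.continuousOn_marginal hs i) (fun _ hy => (h.marginal_pos hs hy).le)
    (h.tendsto_marginal hs i)

end LoadCurve

end Network

theorem firstOrder_of_inactive_or_le {ι : Type*} [Fintype ι] {V : Set (ι → ℝ)} (hV : Convex ℝ V)
    {a b b' φ : ι → ℝ} (ha : a ∈ V ∩ Iic b) (hact : ∀ i, a i < b i ∨ b' i ≤ a i)
    (hfo : ∀ y ∈ V ∩ Iic b, ∑ i, φ i * (y i - a i) ≤ 0) :
    ∀ y ∈ V ∩ Iic b', ∑ i, φ i * (y i - a i) ≤ 0 := by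
  rintro y ⟨hyV, hyb⟩
  have hbox : ∀ᶠ t in 𝓝[>] (0 : ℝ), ∀ i, a i + t * (y i - a i) ≤ b i := by
    refine eventually_all.2 fun i => ?_
    rcases hact i with hi | hi
    · have hlim : Tendsto (fun t : ℝ => a i + t * (y i - a i)) (𝓝 0) (𝓝 (a i + 0 * (y i - a i))) :=
        Continuous.tendsto (by fun_prop) _
      rw [zero_mul, add_zero] at hlim
      exact (hlim.eventually (ge_mem_nhds hi)).filter_mono nhdsWithin_le_nhds
    · filter_upwards [self_mem_nhdsWithin] with t (ht : 0 < t)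
      nlinarith [hyb i, ha.2 i]
  obtain ⟨t, hbox, ht⟩ := (hbox.and (Ioo_mem_nhdsGT (zero_lt_one' ℝ))).exists
  have hstep := hfo (a + t • (y - a)) ⟨hV.add_smul_sub_mem ha.1 hyV ⟨ht.1.le, ht.2.le⟩, hbox⟩
  simp only [Pi.add_apply, Pi.smul_apply, Pi.sub_apply, smul_eq_mul, add_sub_cancel_left,
    mul_left_comm _ t, ← Finset.mul_sum] at hstep
  exact nonpos_of_mul_nonpos_right hstep ht.1

namespace Network

variable {N T : Type*} [Fintype N] [Fintype T] {𝒩 : Network N T} {z p Λ : N → T → ℝ}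
  {G : N → T → ℝ → EReal}

/-- The feasible loads, as a subset of `N × T → ℝ`. -/
def pairLoadSet (𝒩 : Network N T) : Set (N × T → ℝ) := {y | (fun i j => y (i, j)) ∈ 𝒩.loadSet}

theorem convex_pairLoadSet (𝒩 : Network N T) : Convex ℝ 𝒩.pairLoadSet :=
  fun _ hx _ hy _ _ ha hb hab => 𝒩.convex_loadSet hx hy ha hb hab

theorem nonneg_of_mem_pairLoadSet {y : N × T → ℝ} (hy : y ∈ 𝒩.pairLoadSet) : 0 ≤ y :=
  fun x => (mem_loadSet.1 hy).1.1 x.1 x.2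

/-- The `Λ`-parts of the feasible points of the relaxed optimal power flow problem, as a subset of
`N × T → ℝ`. -/
def opfSet (𝒩 : Network N T) : Set (N × T → ℝ) :=
  𝒩.pairLoadSet ∩ Iic fun x => 𝒩.g x.1 x.2 (𝒩.cmax x.2)

theorem exists_opfFeasible_iff :
    (∃ W, 𝒩.OPFFeasible Λ W) ↔ (fun x => Λ x.1 x.2) ∈ 𝒩.opfSet := by
  constructor
  · rintro ⟨W, hW⟩
    exact ⟨mem_loadSet.2 ⟨⟨hW.nonneg, hW.load⟩, W, hW.voltage⟩, fun x => hW.le_max _ _⟩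
  · rintro ⟨hload, hle⟩
    obtain ⟨⟨h0, hM⟩, W, hW⟩ := mem_loadSet.1 hload
    exact ⟨W, hW, hM, h0, fun i j => hle (i, j)⟩

theorem isOPFSolution_iff :
    𝒩.IsOPFSolution G Λ ↔ (fun x => Λ x.1 x.2) ∈ 𝒩.opfSet ∧
      ∀ y ∈ 𝒩.opfSet, ∑ x, G x.1 x.2 (y x) ≤ ∑ x : N × T, G x.1 x.2 (Λ x.1 x.2) := by
  rw [IsOPFSolution, exists_opfFeasible_iff]
  simp only [Fintype.sum_prod_type]
  refine and_congr_right fun _ => ⟨fun hopt y hy => ?_, fun hopt Λ' W' hΛ' => ?_⟩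
  · obtain ⟨W, hW⟩ := (exists_opfFeasible_iff (𝒩 := 𝒩) (Λ := fun i j => y (i, j))).2 hy
    exact hopt _ W hW
  · exact hopt _ (exists_opfFeasible_iff.1 ⟨W', hΛ'⟩)

theorem convex_opfSet (𝒩 : Network N T) : Convex ℝ 𝒩.opfSet :=
  𝒩.convex_pairLoadSet.inter (convex_Iic _)

theorem mem_Icc_of_mem_opfSet {y : N × T → ℝ} (hy : y ∈ 𝒩.opfSet) (x : N × T) :
    y x ∈ Icc 0 (𝒩.g x.1 x.2 (𝒩.cmax x.2)) :=
  ⟨nonneg_of_mem_pairLoadSet hy.1 x, hy.2 x⟩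

theorem Standing.isCompact_opfSet (h : 𝒩.Standing) : IsCompact 𝒩.opfSet := by
  have hcont : Continuous fun (y : N × T → ℝ) i j => y (i, j) := by fun_prop
  exact isCompact_Icc.of_isClosed_subset
    ((h.isCompact_loadSet.isClosed.preimage hcont).inter isClosed_Iic)
    fun _ hy => ⟨nonneg_of_mem_pairLoadSet hy.1, hy.2⟩

theorem Standing.exists_pos_mem_opfSet (h : 𝒩.Standing) (hs : ∀ j, 𝒩.ShortStay j) :
    ∃ y ∈ 𝒩.opfSet, ∀ x, 0 < y x := by
  have hg : ∀ᶠ ε in 𝓝[>] (0 : ℝ), ∀ x : N × T, ε < 𝒩.g x.1 x.2 (𝒩.cmax x.2) :=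
    eventually_all.2 fun x => eventually_nhdsWithin_of_eventually_nhds
      (eventually_lt_nhds (h.g_cmax_pos (hs x.2) x.1))
  obtain ⟨ε, hload, hle, hε : 0 < ε⟩ := ((h.eventually_smul_mem_loadSet
    (Λ := 1) zero_le_one).and (hg.and self_mem_nhdsWithin)).exists
  refine ⟨fun x => (ε • (1 : N → T → ℝ)) x.1 x.2, ⟨hload, fun x => ?_⟩, fun x => ?_⟩
  · simpa using (hle x).le
  · simpa using hε

theorem Standing.eq_of_firstOrder_of_isOPFSolution (h : 𝒩.Standing) (hs : ∀ j, 𝒩.ShortStay j)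
    (hG : ∀ i j, 𝒩.IsPrimitive i j (G i j)) (hΛ : 𝒩.IsOPFSolution G Λ) {m : N × T → ℝ}
    (hm : m ∈ 𝒩.opfSet) (hpos : ∀ x, 0 < m x)
    (hfo : ∀ y ∈ 𝒩.opfSet, ∑ x, 𝒩.marginal x.1 x.2 (m x) * (y x - m x) ≤ 0) :
    Λ = fun i j => m (i, j) := by
  obtain ⟨hmem, hopt⟩ := isOPFSolution_iff.1 hΛ
  by_contra hne
  have hne' : (fun x : N × T => Λ x.1 x.2) ≠ m := fun e =>
    hne (funext₂ fun i j => congrFun e (i, j))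
  exact (sum_lt_of_firstOrder (fun x : N × T => (hG x.1 x.2).isMarginal h (hs x.2))
    (fun x => ⟨hpos x, hm.2 x⟩) (mem_Icc_of_mem_opfSet hmem) hne' (hfo _ hmem)).not_ge (hopt m hm)

theorem Standing.isOPFSolution_iff_firstOrder (h : 𝒩.Standing) (hs : ∀ j, 𝒩.ShortStay j)
    (hG : ∀ i j, 𝒩.IsPrimitive i j (G i j)) :
    𝒩.IsOPFSolution G Λ ↔ (fun x => Λ x.1 x.2) ∈ 𝒩.opfSet ∧ (∀ i j, 0 < Λ i j) ∧
      ∀ y ∈ 𝒩.opfSet, ∑ x : N × T, 𝒩.marginal x.1 x.2 (Λ x.1 x.2) * (y x - Λ x.1 x.2) ≤ 0 := by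
  have hmarg := fun x : N × T => (hG x.1 x.2).isMarginal h (hs x.2)
  constructor
  · intro hΛ
    obtain ⟨e, he, hepos⟩ := h.exists_pos_mem_opfSet hs
    obtain ⟨m, hm, hpos, hfo, -⟩ := exists_strict_maximizer hmarg 𝒩.convex_opfSet
      h.isCompact_opfSet (fun y hy => mem_Icc_of_mem_opfSet hy) he hepos
    obtain rfl := h.eq_of_firstOrder_of_isOPFSolution hs hG hΛ hm hpos hfo
    exact ⟨hm, fun i j => hpos (i, j), hfo⟩
  · rintro ⟨hΛ, hpos, hfo⟩
    refine isOPFSolution_iff.2 ⟨hΛ, fun y hy => ?_⟩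
    rcases eq_or_ne y fun x => Λ x.1 x.2 with rfl | hne
    · exact le_rfl
    · exact (sum_lt_of_firstOrder hmarg (fun x => ⟨hpos _ _, hΛ.2 x⟩)
        (mem_Icc_of_mem_opfSet hy) hne (hfo y hy)).le

theorem Standing.existsUnique_isOPFSolution (h : 𝒩.Standing) (hs : ∀ j, 𝒩.ShortStay j)
    (hG : ∀ i j, 𝒩.IsPrimitive i j (G i j)) : ∃! Λ, 𝒩.IsOPFSolution G Λ := by
  obtain ⟨e, he, hepos⟩ := h.exists_pos_mem_opfSet hs
  obtain ⟨m, hm, hpos, hfo, -⟩ := exists_strict_maximizer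
    (fun x : N × T => (hG x.1 x.2).isMarginal h (hs x.2)) 𝒩.convex_opfSet h.isCompact_opfSet
    (fun y hy => mem_Icc_of_mem_opfSet hy) he hepos
  exact ⟨fun i j => m (i, j),
    (h.isOPFSolution_iff_firstOrder hs hG).2 ⟨hm, fun i j => hpos (i, j), hfo⟩,
    fun Λ hΛ => h.eq_of_firstOrder_of_isOPFSolution hs hG hΛ hm hpos hfo⟩

theorem mul_mem_rateSet_iff (hz : ∀ i j, 0 < z i j) {p : N × T → ℝ} :
    p ∈ 𝒩.rateSet z ↔ (fun x => z x.1 x.2 * p x) ∈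
      𝒩.pairLoadSet ∩ Iic fun x => z x.1 x.2 * 𝒩.cmax x.2 := by
  constructor
  · rintro ⟨hbox, hload⟩
    exact ⟨hload, fun x => mul_le_mul_of_nonneg_left (hbox x).2 (hz _ _).le⟩
  · rintro ⟨hload, hle⟩
    exact ⟨fun x => ⟨nonneg_of_mul_nonneg_right (nonneg_of_mem_pairLoadSet hload x) (hz _ _),
      le_of_mul_le_mul_left (hle x) (hz _ _)⟩, hload⟩

theorem Standing.rate_eq_iff_firstOrder_load (h : 𝒩.Standing) (hz : ∀ i j, 0 < z i j) :
    𝒩.rate z = p ↔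
      (fun x => z x.1 x.2 * p x.1 x.2) ∈
        (𝒩.pairLoadSet ∩ Iic fun x => z x.1 x.2 * 𝒩.cmax x.2) ∧ (∀ i j, 0 < p i j) ∧
      ∀ y ∈ 𝒩.pairLoadSet ∩ Iic fun x => z x.1 x.2 * 𝒩.cmax x.2,
        ∑ x : N × T, derivE (𝒩.u x.1 x.2) (p x.1 x.2) * (y x - z x.1 x.2 * p x.1 x.2) ≤ 0 := by
  have hterm : ∀ (y : N × T → ℝ) (x : N × T),
      z x.1 x.2 * derivE (𝒩.u x.1 x.2) (p x.1 x.2) * (y x - p x.1 x.2)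
        = derivE (𝒩.u x.1 x.2) (p x.1 x.2) * (z x.1 x.2 * y x - z x.1 x.2 * p x.1 x.2) := by
    intro y x
    ring
  rw [h.rate_eq_iff_firstOrder hz, mul_mem_rateSet_iff hz]
  simp only [hterm, mul_mem_rateSet_iff hz]
  refine and_congr_right fun _ => and_congr_right fun _ => ⟨fun hfo y hy => ?_, fun hfo y hy => ?_⟩
  · have hzy : (fun x : N × T => z x.1 x.2 * (y x / z x.1 x.2)) = y :=
      funext fun x => mul_div_cancel₀ _ (hz _ _).ne'
    have := hfo (fun x => y x / z x.1 x.2) (by rwa [hzy])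
    simpa only [mul_div_cancel₀ _ (hz _ _).ne'] using this
  · exact hfo _ hy

theorem Standing.rate_eq_iff_isOPFSolution (h : 𝒩.Standing) (hs : ∀ j, 𝒩.ShortStay j)
    (hG : ∀ i j, 𝒩.IsPrimitive i j (G i j)) (hz : ∀ i j, 0 < z i j)
    (hp : ∀ i j, p i j ∈ Ioc 0 (𝒩.cmax j)) (hg : ∀ i j, z i j * p i j = 𝒩.g i j (p i j)) :
    𝒩.rate z = p ↔ 𝒩.IsOPFSolution G fun i j => z i j * p i j := by
  have hp' : ∀ i j, p i j ∈ Icc 0 (𝒩.cmax j) := fun i j => Ioc_subset_Icc_self (hp i j)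
  have hmarg : ∀ i j, 𝒩.marginal i j (z i j * p i j) = derivE (𝒩.u i j) (p i j) := fun i j => by
    rw [marginal, hg, h.gInv_g (hs j) (hp' i j)]
  have hle : ∀ i j, z i j * p i j ≤ 𝒩.g i j (𝒩.cmax j) := fun i j => hg i j ▸
    (h.strictMonoOn_g (hs j) i).monotoneOn (hp' i j) ⟨(h.cmax_pos j).le, le_rfl⟩ (hp i j).2
  have hle' : ∀ i j, z i j * p i j ≤ z i j * 𝒩.cmax j := fun i j =>
    mul_le_mul_of_nonneg_left (hp i j).2 (hz i j).le
  have hact : ∀ i j, z i j * p i j < z i j * 𝒩.cmax j ∧ z i j * p i j < 𝒩.g i j (𝒩.cmax j) ∨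
      z i j * 𝒩.cmax j ≤ z i j * p i j ∧ 𝒩.g i j (𝒩.cmax j) ≤ z i j * p i j := fun i j => by
    rcases (hp i j).2.lt_or_eq with hlt | heq
    · refine .inl ⟨mul_lt_mul_of_pos_left hlt (hz i j), hg i j ▸ ?_⟩
      exact h.strictMonoOn_g (hs j) i (hp' i j) ⟨(h.cmax_pos j).le, le_rfl⟩ hlt
    · exact .inr ⟨(congrArg _ heq).ge, ((hg i j).trans (congrArg _ heq)).ge⟩
  rw [h.rate_eq_iff_firstOrder_load hz, h.isOPFSolution_iff_firstOrder hs hG]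
  simp only [hmarg]
  constructor
  · rintro ⟨hmem, -, hfo⟩
    exact ⟨⟨hmem.1, fun x => hle _ _⟩, fun i j => mul_pos (hz i j) (hp i j).1,
      firstOrder_of_inactive_or_le 𝒩.convex_pairLoadSet hmem
        (fun x => (hact x.1 x.2).imp And.left And.right) hfo⟩
  · rintro ⟨hmem, -, hfo⟩
    exact ⟨⟨hmem.1, fun x => hle' _ _⟩, fun i j => (hp i j).1,
      firstOrder_of_inactive_or_le 𝒩.convex_pairLoadSet hmem
        (fun x => (hact x.1 x.2).imp And.right And.left) hfo⟩

theorem Standing.rate_mem_Ioc (h : 𝒩.Standing) (hz : ∀ i j, 0 < z i j) (i : N) (j : T) :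
    𝒩.rate z i j ∈ Ioc 0 (𝒩.cmax j) :=
  have ⟨hmem, hpos, _⟩ := (h.rate_eq_iff_firstOrder hz).1 rfl
  ⟨hpos i j, (hmem.1 (i, j)).2⟩

theorem IsFixedPoint.pos (hz : 𝒩.IsFixedPoint z) (h : 𝒩.Standing) (i : N) (j : T) :
    0 < z i j := by
  have := h.prob j
  rw [hz.2 i j]
  exact mul_pos (h.gam_pos i j) (integral_sojourn_pos (h.B_pos j) (h.D_pos j) (h.D_integrable j)
    ((h.isChargingRate_rate hz.1).feasible.nonneg i j))

omit [Fintype N] in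
theorem gam_mul_integral_sojourn_mul (i : N) (j : T) {p : ℝ} (hp : 0 < p) :
    (𝒩.gam i j * ∫ x, sojourn x.1 x.2 p ∂𝒩.F j) * p = 𝒩.g i j p := by
  rw [mul_assoc, integral_sojourn_mul hp, g]

theorem IsFixedPoint.mul_rate (hz : 𝒩.IsFixedPoint z) (h : 𝒩.Standing) (i : N) (j : T) :
    z i j * 𝒩.rate z i j = 𝒩.g i j (𝒩.rate z i j) := by
  conv_lhs => rw [hz.2 i j]
  exact gam_mul_integral_sojourn_mul i j (h.rate_mem_Ioc (hz.pos h) i j).1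

theorem IsFixedPoint.isOPFSolution (hz : 𝒩.IsFixedPoint z) (h : 𝒩.Standing)
    (hs : ∀ j, 𝒩.ShortStay j) (hG : ∀ i j, 𝒩.IsPrimitive i j (G i j)) :
    𝒩.IsOPFSolution G fun i j => z i j * 𝒩.rate z i j :=
  (h.rate_eq_iff_isOPFSolution hs hG (hz.pos h) (h.rate_mem_Ioc (hz.pos h)) (hz.mul_rate h)).1 rfl

theorem IsOPFSolution.isFixedPoint (hΛ : 𝒩.IsOPFSolution G Λ) (h : 𝒩.Standing)
    (hs : ∀ j, 𝒩.ShortStay j) (hG : ∀ i j, 𝒩.IsPrimitive i j (G i j)) :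
    𝒩.IsFixedPoint fun i j => Λ i j / 𝒩.gInv i j (Λ i j) := by
  obtain ⟨hmem, hpos, -⟩ := (h.isOPFSolution_iff_firstOrder hs hG).1 hΛ
  have hΛ' : ∀ i j, Λ i j ∈ Ioc 0 (𝒩.g i j (𝒩.cmax j)) := fun i j => ⟨hpos i j, hmem.2 (i, j)⟩
  have hg : ∀ i j, 𝒩.g i j (𝒩.gInv i j (Λ i j)) = Λ i j := fun i j =>
    h.g_gInv (hs j) (Ioc_subset_Icc_self (hΛ' i j))
  have hp : ∀ i j, 𝒩.gInv i j (Λ i j) ∈ Ioc 0 (𝒩.cmax j) := fun i j =>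
    ⟨h.gInv_pos (hs j) (hΛ' i j), (h.gInv_mem (hs j) (Ioc_subset_Icc_self (hΛ' i j))).2⟩
  have hz : ∀ i j, 0 < Λ i j / 𝒩.gInv i j (Λ i j) := fun i j => div_pos (hpos i j) (hp i j).1
  have hzp : ∀ i j, Λ i j / 𝒩.gInv i j (Λ i j) * 𝒩.gInv i j (Λ i j) = Λ i j := fun i j =>
    div_mul_cancel₀ _ (hp i j).1.ne'
  have hrate := (h.rate_eq_iff_isOPFSolution hs hG hz hp fun i j => by rw [hzp, hg]).2
    (by simpa only [hzp] using hΛ)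
  refine ⟨fun i j => (hz i j).le, fun i j => ?_⟩
  rw [hrate, div_eq_iff (hp i j).1.ne', gam_mul_integral_sojourn_mul i j (hp i j).1, hg]

theorem IsFixedPoint.eq_div_gInv (hz : 𝒩.IsFixedPoint z) (h : 𝒩.Standing)
    (hs : ∀ j, 𝒩.ShortStay j) (hG : ∀ i j, 𝒩.IsPrimitive i j (G i j))
    (hΛ : 𝒩.IsOPFSolution G Λ) (i : N) (j : T) : z i j = Λ i j / 𝒩.gInv i j (Λ i j) := by
  have hp := h.rate_mem_Ioc (hz.pos h) i j
  obtain rfl := (h.existsUnique_isOPFSolution hs hG).unique hΛ (hz.isOPFSolution h hs hG)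
  have hgInv : 𝒩.gInv i j (z i j * 𝒩.rate z i j) = 𝒩.rate z i j := by
    rw [hz.mul_rate h, h.gInv_g (hs j) (Ioc_subset_Icc_self hp)]
  simp only [hgInv, mul_div_cancel_right₀ _ hp.1.ne']

theorem Standing.existsUnique_isFixedPoint (h : 𝒩.Standing) (hs : ∀ j, 𝒩.ShortStay j)
    (hG : ∀ i j, 𝒩.IsPrimitive i j (G i j)) : ∃! z, 𝒩.IsFixedPoint z :=
  have ⟨_, hΛ⟩ := (h.existsUnique_isOPFSolution hs hG).exists
  ⟨_, hΛ.isFixedPoint h hs hG, fun _ hz => funext₂ (hz.eq_div_gInv h hs hG hΛ)⟩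

end Network

theorem tendsto_average {f : ℝ → ℝ} {l : ℝ} (hi : ∀ t, 0 ≤ t → IntervalIntegrable f volume 0 t)
    (hf : Tendsto f atTop (𝓝 l)) :
    Tendsto (fun t => (∫ s in 0..t, f s) / t) atTop (𝓝 l) := by
  rw [Metric.tendsto_atTop]
  intro ε hε
  obtain ⟨τ, hτ0, hτ⟩ : ∃ τ, 0 ≤ τ ∧ ∀ s, τ ≤ s → |f s - l| ≤ ε / 2 := by
    obtain ⟨τ, hτ⟩ := Metric.tendsto_atTop.1 hf (ε / 2) (half_pos hε)
    exact ⟨max τ 0, le_max_right _ _, fun s hs => (hτ s ((le_max_left _ _).trans hs)).le⟩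
  set c := |∫ s in 0..τ, (f s - l)|
  refine ⟨max (τ + 1) (2 * c / ε + 1), fun t ht => ?_⟩
  obtain ⟨hτt, hct⟩ := max_le_iff.1 ht
  have ht0 : 0 < t := by linarith
  have hil (t : ℝ) (ht : 0 ≤ t) : IntervalIntegrable (fun s => f s - l) volume 0 t :=
    (hi t ht).sub intervalIntegrable_const
  have hsplit : |∫ s in 0..t, (f s - l)| ≤ c + |∫ s in τ..t, (f s - l)| := by
    rw [← intervalIntegral.integral_add_adjacent_intervals (hil τ hτ0)
      ((hil τ hτ0).symm.trans (hil t ht0.le))]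
    exact abs_add_le _ _
  have htail : |∫ s in τ..t, (f s - l)| ≤ ε / 2 * |t - τ| :=
    intervalIntegral.norm_integral_le_of_norm_le_const (f := fun s => f s - l) fun s hs =>
      hτ s (uIoc_of_le (by linarith : τ ≤ t) ▸ hs).1.le
  have hhead : c < ε / 2 * t := by
    have : 2 * c / ε < t := by linarith
    rw [div_lt_iff₀ hε] at this
    linarith
  have hsub : (∫ s in 0..t, f s) / t - l = (∫ s in 0..t, (f s - l)) / t := by
    rw [intervalIntegral.integral_sub (hi t ht0.le) intervalIntegrable_const,
      intervalIntegral.integral_const, smul_eq_mul, sub_zero, sub_div,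
      mul_div_cancel_left₀ _ ht0.ne']
  rw [abs_of_nonneg (by linarith : 0 ≤ t - τ)] at htail
  rw [Real.dist_eq, hsub, abs_div, abs_of_pos ht0, div_lt_iff₀ ht0]
  nlinarith

/-- The forward convolution `∫₀ᵗ a(s) h(t - s) ds`: the mass present at time `t` when mass enters at
rate `a` and a fraction `h(u)` of it is still present a time `u` later. -/
def conv (a h : ℝ → ℝ) (t : ℝ) : ℝ := ∫ s in 0..t, a s * h (t - s)

section Convolution

variable {a h : ℝ → ℝ} {t x y T : ℝ}

theorem conv_one : conv 1 h t = ∫ u in 0..t, h u := by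
  simp [conv, intervalIntegral.integral_comp_sub_left (fun u => h u) t]

theorem integral_mul_comp_sub_nonneg (ha0 : ∀ s, 0 ≤ a s) (h0 : ∀ u, 0 ≤ h u) (hxy : x ≤ y) :
    0 ≤ ∫ s in x..y, a s * h (t - s) :=
  intervalIntegral.integral_nonneg hxy fun s _ => mul_nonneg (ha0 s) (h0 _)

theorem conv_indicator_Iic (ht : 0 ≤ t) (htT : t ≤ T) :
    conv ((Iic T).indicator a) h t = conv a h t := by
  refine intervalIntegral.integral_congr fun s hs => ?_
  rw [uIcc_of_le ht] at hs
  simp only [indicator_of_mem (mem_Iic.2 (hs.2.trans htT))]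

theorem conv_sum_const_mul {ι : Type*} (s : Finset ι) (c : ι → ℝ) {h : ι → ℝ → ℝ}
    (hi : ∀ j ∈ s, IntervalIntegrable (fun r => a r * h j (t - r)) volume 0 t) :
    conv a (fun u => ∑ j ∈ s, c j * h j u) t = ∑ j ∈ s, c j * conv a (h j) t := by
  simp only [conv, Finset.mul_sum, mul_left_comm _ (c _)]
  rw [intervalIntegral.integral_finsetSum fun j hj => (hi j hj).const_mul (c j)]
  simp only [intervalIntegral.integral_const_mul]

theorem integrableOn_indicator_Iic (hT : 0 ≤ T) (ha : IntervalIntegrable a volume 0 T) :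
    IntegrableOn ((Iic T).indicator a) (Ioi 0) := by
  rw [intervalIntegrable_iff_integrableOn_Ioc_of_le hT, ← Ioi_inter_Iic, inter_comm] at ha
  rwa [IntegrableOn, integrable_indicator_iff measurableSet_Iic, IntegrableOn,
    Measure.restrict_restrict measurableSet_Iic]

theorem integrableOn_conv (ha : IntegrableOn a (Ioi 0)) (hh : IntegrableOn h (Ioi 0)) :
    IntegrableOn (conv a h) (Ioi 0) :=
  (integrable_indicator_iff measurableSet_Ioi).1
    (integrable_posConvolution ha hh (ContinuousLinearMap.mul ℝ ℝ))

theorem intervalIntegrable_conv (hT : 0 ≤ T) (ha : IntervalIntegrable a volume 0 T)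
    (hh : IntegrableOn h (Ioi 0)) : IntervalIntegrable (conv a h) volume 0 T := by
  rw [intervalIntegrable_iff_integrableOn_Ioc_of_le hT]
  refine ((integrableOn_conv (integrableOn_indicator_Iic hT ha) hh).mono_set
    Ioc_subset_Ioi_self).congr_fun (fun t ht => ?_) measurableSet_Ioc
  exact conv_indicator_Iic ht.1.le ht.2

theorem integral_conv_le (hT : 0 ≤ T) (ha : IntervalIntegrable a volume 0 T)
    (ha0 : ∀ s, 0 ≤ a s) (hh : IntegrableOn h (Ioi 0)) (h0 : ∀ u, 0 ≤ h u) :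
    ∫ t in 0..T, conv a h t ≤ (∫ s in 0..T, a s) * ∫ u in Ioi 0, h u := by
  set b := (Iic T).indicator a
  have hb := integrableOn_indicator_Iic hT ha
  have hb0 (s : ℝ) : 0 ≤ b s := indicator_nonneg (fun s _ => ha0 s) s
  calc ∫ t in 0..T, conv a h t = ∫ t in Ioc 0 T, conv b h t := by
        rw [intervalIntegral.integral_of_le hT]
        exact setIntegral_congr_fun measurableSet_Ioc fun t ht =>
          (conv_indicator_Iic ht.1.le ht.2).symm
    _ ≤ ∫ t in Ioi 0, conv b h t :=
        setIntegral_mono_set (integrableOn_conv hb hh)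
          ((ae_restrict_mem measurableSet_Ioi).mono fun t ht =>
            integral_mul_comp_sub_nonneg hb0 h0 (le_of_lt ht))
          Ioc_subset_Ioi_self.eventuallyLE
    _ = (∫ s in Ioi 0, b s) * ∫ u in Ioi 0, h u :=
        integral_posConvolution hb hh (ContinuousLinearMap.mul ℝ ℝ)
    _ = (∫ s in 0..T, a s) * ∫ u in Ioi 0, h u := by
        rw [setIntegral_indicator measurableSet_Iic, Ioi_inter_Iic,
          intervalIntegral.integral_of_le hT]

theorem intervalIntegrable_of_mem_Icc (ha : Measurable a) (ha1 : ∀ s, a s ∈ Icc (0 : ℝ) 1) :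
    IntervalIntegrable a volume x y :=
  (intervalIntegrable_const (c := (1 : ℝ))).mono_fun' ha.aestronglyMeasurable
    (Eventually.of_forall fun s => (Real.norm_of_nonneg (ha1 s).1).trans_le (ha1 s).2)

theorem intervalIntegrable_mul_comp_sub (ha : Measurable a) (ha1 : ∀ s, a s ∈ Icc (0 : ℝ) 1)
    (hh : IntervalIntegrable h volume (t - x) (t - y)) :
    IntervalIntegrable (fun s => a s * h (t - s)) volume x y := by
  have hht : IntervalIntegrable (fun s => h (t - s)) volume x y := by
    simpa only [sub_sub_cancel] using hh.comp_sub_left t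
  have hbound (s : ℝ) : ‖a s‖ ≤ 1 := (Real.norm_of_nonneg (ha1 s).1).trans_le (ha1 s).2
  exact ⟨hht.1.bdd_mul ha.aestronglyMeasurable (Eventually.of_forall hbound),
    hht.2.bdd_mul ha.aestronglyMeasurable (Eventually.of_forall hbound)⟩

theorem intervalIntegrable_of_integrableOn_Ioi (hh : IntegrableOn h (Ioi 0)) (ht : 0 ≤ t) :
    IntervalIntegrable h volume 0 t :=
  (intervalIntegrable_iff_integrableOn_Ioc_of_le ht).2 (hh.mono_set Ioc_subset_Ioi_self)

theorem conv_one_sub (ha : Measurable a) (ha1 : ∀ s, a s ∈ Icc (0 : ℝ) 1)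
    (hh : IntegrableOn h (Ioi 0)) (ht : 0 ≤ t) :
    conv (1 - a) h t = (∫ u in 0..t, h u) - conv a h t := by
  have hht : IntervalIntegrable h volume (t - 0) (t - t) := by
    simpa only [sub_zero, sub_self] using (intervalIntegrable_of_integrableOn_Ioi hh ht).symm
  rw [← conv_one]
  simp only [conv, Pi.sub_apply, sub_mul]
  exact intervalIntegral.integral_sub
    (intervalIntegrable_mul_comp_sub measurable_one (fun _ => ⟨zero_le_one, le_rfl⟩) hht)
    (intervalIntegrable_mul_comp_sub ha ha1 hht)

theorem tendsto_average_conv_sub (ha : Measurable a) (ha1 : ∀ s, a s ∈ Icc (0 : ℝ) 1)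
    (hh : IntegrableOn h (Ioi 0)) (h0 : ∀ u, 0 ≤ h u) :
    Tendsto (fun T => (∫ t in 0..T, conv a h t) / T
      - (∫ s in 0..T, a s) / T * ∫ u in Ioi 0, h u) atTop (𝓝 0) := by
  set I := ∫ u in Ioi 0, h u
  have hprim (T : ℝ) (hT : 0 ≤ T) :
      IntervalIntegrable (fun t => ∫ u in 0..t, h u) volume 0 T := by
    simp only [← conv_one]
    exact intervalIntegrable_conv hT intervalIntegrable_const hh
  have hlower : Tendsto (fun T => (∫ t in 0..T, ∫ u in 0..t, h u) / T - I) atTop (𝓝 0) := by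
    have hI : Tendsto (fun t => ∫ u in 0..t, h u) atTop (𝓝 I) :=
      intervalIntegral_tendsto_integral_Ioi 0 hh tendsto_id
    simpa only [sub_self] using (tendsto_average hprim hI).sub_const I
  refine tendsto_of_tendsto_of_tendsto_of_le_of_le' hlower tendsto_const_nhds ?_ ?_
  -- The upper bound of `integral_conv_le`, applied to `1 - a`, is the lower bound for `a`.
  · filter_upwards [eventually_gt_atTop 0] with T hT
    have hai : IntervalIntegrable a volume 0 T := intervalIntegrable_of_mem_Icc ha ha1
    have hsub : IntervalIntegrable (1 - a) volume 0 T := intervalIntegrable_const.sub hai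
    have hle : _ ≤ _ * I := integral_conv_le hT.le hsub (fun s => sub_nonneg.2 (ha1 s).2) hh h0
    rw [intervalIntegral.integral_congr (g := fun t => (∫ u in 0..t, h u) - conv a h t)
        fun t ht => conv_one_sub ha ha1 hh (uIcc_of_le hT.le ▸ ht).1,
      intervalIntegral.integral_sub (hprim T hT.le) (intervalIntegrable_conv hT.le hai hh)] at hle
    simp only [Pi.sub_apply, Pi.one_apply] at hle
    rw [intervalIntegral.integral_sub intervalIntegrable_const hai,
      intervalIntegral.integral_const, smul_eq_mul, mul_one, sub_zero] at hle
    rw [div_mul_eq_mul_div, ← sub_div, div_sub' hT.ne']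
    exact div_le_div_of_nonneg_right (by linarith) hT.le
  · filter_upwards [eventually_gt_atTop 0] with T hT
    rw [div_mul_eq_mul_div, ← sub_div]
    exact div_nonpos_of_nonpos_of_nonneg (sub_nonpos.2
      (integral_conv_le hT.le (intervalIntegrable_of_mem_Icc ha ha1) (fun s => (ha1 s).1) hh h0))
      hT.le

end Convolution

section AntitoneSurvival

variable {a Φ : ℝ → ℝ} {t' t : ℝ}

-- Arrivals during `(t', t]` that are still present at `t`, minus departures during that time.
theorem conv_sub_conv (ha : Measurable a) (ha1 : ∀ s, a s ∈ Icc (0 : ℝ) 1) (hΦ : Antitone Φ)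
    (t' t : ℝ) :
    conv a Φ t - conv a Φ t' = (∫ s in t'..t, a s * Φ (t - s))
      - ∫ s in 0..t', a s * (Φ (t' - s) - Φ (t - s)) := by
  have hi (t x y : ℝ) : IntervalIntegrable (fun s => a s * Φ (t - s)) volume x y :=
    intervalIntegrable_mul_comp_sub ha ha1 hΦ.intervalIntegrable
  simp only [mul_sub]
  rw [conv, conv, intervalIntegral.integral_sub (hi t' 0 t') (hi t 0 t'),
    ← intervalIntegral.integral_add_adjacent_intervals (hi t 0 t') (hi t t' t)]
  ring

theorem departures_nonneg (ha0 : ∀ s, 0 ≤ a s) (hΦ : Antitone Φ) (ht' : 0 ≤ t') (ht : t' ≤ t) :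
    0 ≤ ∫ s in 0..t', a s * (Φ (t' - s) - Φ (t - s)) :=
  intervalIntegral.integral_nonneg ht' fun s _ =>
    mul_nonneg (ha0 s) (sub_nonneg.2 (hΦ (by linarith)))

theorem departures_le (ha : Measurable a) (ha1 : ∀ s, a s ∈ Icc (0 : ℝ) 1) (hΦ : Antitone Φ)
    (hΦ0 : ∀ u, 0 ≤ Φ u) (ht' : 0 ≤ t') (ht : t' ≤ t) :
    ∫ s in 0..t', a s * (Φ (t' - s) - Φ (t - s)) ≤ ∫ u in 0..(t - t'), Φ u := by
  have hi (x y : ℝ) : IntervalIntegrable Φ volume x y := hΦ.intervalIntegrable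
  have hone : ∀ s : ℝ, (1 : ℝ → ℝ) s ∈ Icc (0 : ℝ) 1 := fun _ => ⟨zero_le_one, le_rfl⟩
  have hia (b : ℝ → ℝ) (hb : Measurable b) (hb1 : ∀ s, b s ∈ Icc (0 : ℝ) 1) :
      IntervalIntegrable (fun s => b s * (Φ (t' - s) - Φ (t - s))) volume 0 t' := by
    simp only [mul_sub]
    exact (intervalIntegrable_mul_comp_sub hb hb1 (hi _ _)).sub
      (intervalIntegrable_mul_comp_sub hb hb1 (hi _ _))
  calc ∫ s in 0..t', a s * (Φ (t' - s) - Φ (t - s))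
      ≤ ∫ s in 0..t', (1 : ℝ → ℝ) s * (Φ (t' - s) - Φ (t - s)) :=
        intervalIntegral.integral_mono_on ht' (hia a ha ha1) (hia 1 measurable_one hone) fun s _ =>
          mul_le_mul_of_nonneg_right (ha1 s).2 (sub_nonneg.2 (hΦ (by linarith)))
    _ = (∫ s in t'..t, (1 : ℝ → ℝ) s * Φ (t - s)) - (conv 1 Φ t - conv 1 Φ t') := by
        rw [conv_sub_conv measurable_one hone hΦ, sub_sub_cancel]
    _ = (∫ u in 0..(t - t'), Φ u) - ∫ u in t'..t, Φ u := by
        rw [conv_one, conv_one, intervalIntegral.integral_interval_sub_left (hi 0 t) (hi 0 t')]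
        simp [intervalIntegral.integral_comp_sub_left (fun s => Φ s)]
    _ ≤ ∫ u in 0..(t - t'), Φ u :=
        sub_le_self _ (intervalIntegral.integral_nonneg ht fun u _ => hΦ0 u)

theorem arrivals_le (ha : Measurable a) (ha1 : ∀ s, a s ∈ Icc (0 : ℝ) 1) (hΦ : Antitone Φ)
    (hΦ0 : ∀ u, 0 ≤ Φ u) (ht : t' ≤ t) :
    ∫ s in t'..t, a s * Φ (t - s) ≤ ∫ u in 0..(t - t'), Φ u := by
  have hi : IntervalIntegrable (fun s => Φ (t - s)) volume t' t := by
    simpa only [sub_sub_cancel] using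
      (hΦ.intervalIntegrable (a := t - t') (b := t - t) (μ := volume)).comp_sub_left t
  calc ∫ s in t'..t, a s * Φ (t - s) ≤ ∫ s in t'..t, Φ (t - s) :=
        intervalIntegral.integral_mono_on ht
          (intervalIntegrable_mul_comp_sub ha ha1 hΦ.intervalIntegrable) hi
          fun s _ => mul_le_of_le_one_left (hΦ0 _) (ha1 s).2
    _ = ∫ u in 0..(t - t'), Φ u := by
        rw [intervalIntegral.integral_comp_sub_left (fun u => Φ u), sub_self]

theorem arrivals_eq_zero_of_off (ht : t' ≤ t) (hoff : ∀ s ∈ Ioc t' t, a s = 0) :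
    ∫ s in t'..t, a s * Φ (t - s) = 0 :=
  intervalIntegral.integral_zero_ae <| Eventually.of_forall fun s hs => by
    rw [hoff s (uIoc_of_le ht ▸ hs), zero_mul]

theorem arrivals_eq_of_on (ht : t' ≤ t) (hon : ∀ s ∈ Ioc t' t, a s = 1) :
    ∫ s in t'..t, a s * Φ (t - s) = ∫ u in 0..(t - t'), Φ u := by
  rw [intervalIntegral.integral_congr_ae (g := fun s => Φ (t - s)),
    intervalIntegral.integral_comp_sub_left (fun u => Φ u), sub_self]
  exact Eventually.of_forall fun s hs => by rw [hon s (uIoc_of_le ht ▸ hs), one_mul]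

theorem conv_le_of_off (ha : Measurable a) (ha1 : ∀ s, a s ∈ Icc (0 : ℝ) 1) (hΦ : Antitone Φ)
    (ht' : 0 ≤ t') (ht : t' ≤ t) (hoff : ∀ s ∈ Ioc t' t, a s = 0) :
    conv a Φ t ≤ conv a Φ t' := by
  have hsub := conv_sub_conv ha ha1 hΦ t' t
  rw [arrivals_eq_zero_of_off ht hoff] at hsub
  linarith [departures_nonneg (fun s => (ha1 s).1) hΦ ht' ht]

theorem conv_le_of_on (ha : Measurable a) (ha1 : ∀ s, a s ∈ Icc (0 : ℝ) 1) (hΦ : Antitone Φ)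
    (hΦ0 : ∀ u, 0 ≤ Φ u) (ht' : 0 ≤ t') (ht : t' ≤ t) (hon : ∀ s ∈ Ioc t' t, a s = 1) :
    conv a Φ t' ≤ conv a Φ t := by
  have hsub := conv_sub_conv ha ha1 hΦ t' t
  rw [arrivals_eq_of_on ht hon] at hsub
  linarith [departures_le ha ha1 hΦ hΦ0 ht' ht]

theorem integral_le_conv_of_on (ha : Measurable a) (ha1 : ∀ s, a s ∈ Icc (0 : ℝ) 1)
    (hΦ : Antitone Φ) (hΦ0 : ∀ u, 0 ≤ Φ u) (ht' : 0 ≤ t') (ht : t' ≤ t)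
    (hon : ∀ s ∈ Ioc t' t, a s = 1) : ∫ u in 0..(t - t'), Φ u ≤ conv a Φ t := by
  have hi (x y : ℝ) : IntervalIntegrable (fun s => a s * Φ (t - s)) volume x y :=
    intervalIntegrable_mul_comp_sub ha ha1 hΦ.intervalIntegrable
  rw [conv, ← intervalIntegral.integral_add_adjacent_intervals (hi 0 t') (hi t' t),
    arrivals_eq_of_on ht hon]
  exact le_add_of_nonneg_left (integral_mul_comp_sub_nonneg (fun s => (ha1 s).1) hΦ0 ht')

theorem abs_conv_sub_conv_le (ha : Measurable a) (ha1 : ∀ s, a s ∈ Icc (0 : ℝ) 1)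
    (hΦ : Antitone Φ) (hΦ0 : ∀ u, 0 ≤ Φ u) (ht' : 0 ≤ t') (ht : t' ≤ t) :
    |conv a Φ t - conv a Φ t'| ≤ ∫ u in 0..(t - t'), Φ u := by
  rw [conv_sub_conv ha ha1 hΦ]
  exact abs_sub_le_of_nonneg_of_le (integral_mul_comp_sub_nonneg (fun s => (ha1 s).1) hΦ0 ht)
    (arrivals_le ha ha1 hΦ hΦ0 ht)
    (departures_nonneg (fun s => (ha1 s).1) hΦ ht' ht) (departures_le ha ha1 hΦ hΦ0 ht' ht)

theorem continuousWithinAt_conv (ha : Measurable a) (ha1 : ∀ s, a s ∈ Icc (0 : ℝ) 1)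
    (hΦ : Antitone Φ) (hΦ0 : ∀ u, 0 ≤ Φ u) (ht : 0 < t) :
    ContinuousWithinAt (conv a Φ) (Iic t) t := by
  have hlim : Tendsto (fun s => ∫ u in 0..(t - s), Φ u) (𝓝[≤] t) (𝓝 0) := by
    have hc : Continuous fun s => ∫ u in 0..(t - s), Φ u :=
      (intervalIntegral.continuous_primitive (fun _ _ => hΦ.intervalIntegrable) 0).comp
        (continuous_const.sub continuous_id)
    simpa using (hc.tendsto t).mono_left nhdsWithin_le_nhds
  rw [ContinuousWithinAt, tendsto_iff_norm_sub_tendsto_zero]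
  refine squeeze_zero' (Eventually.of_forall fun _ => norm_nonneg _) ?_ hlim
  filter_upwards [nhdsWithin_le_nhds (lt_mem_nhds ht), self_mem_nhdsWithin] with s hs hst
  rw [Real.norm_eq_abs, abs_sub_comm]
  exact abs_conv_sub_conv_le ha ha1 hΦ hΦ0 hs.le hst

end AntitoneSurvival

theorem exists_last_le {f : ℝ → ℝ} {K a b : ℝ} (hab : a ≤ b)
    (hf : ∀ s ∈ Icc a b, ContinuousWithinAt f (Iic s) s) (ha : f a ≤ K) :
    ∃ σ ∈ Icc a b, f σ ≤ K ∧ ∀ s ∈ Ioc σ b, K < f s := by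
  set A := {s ∈ Icc a b | f s ≤ K}
  have haA : a ∈ A := ⟨left_mem_Icc.2 hab, ha⟩
  have hlub : IsLUB A (sSup A) := isLUB_csSup ⟨a, haA⟩ ⟨b, fun s hs => hs.1.2⟩
  have hσ : sSup A ∈ Icc a b := ⟨hlub.1 haA, hlub.2 fun s hs => hs.1.2⟩
  refine ⟨sSup A, hσ, ?_, fun s hs => ?_⟩
  · exact le_of_tendsto_of_frequently (hf _ hσ)
      ((hlub.frequently_mem ⟨a, haA⟩).mono fun s hs => hs.2)
  · by_contra! hsK
    exact (hlub.1 ⟨⟨hσ.1.trans hs.1.le, hs.2⟩, hsK⟩).not_gt hs.1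

/-- A fluid loss system of capacity `K`. The population `q` consists of the survivors `S` of the
initial population and of those admitted later: `Φ u` is the arrival rate multiplied by the
probability that a newcomer stays for at least time `u`, and `a` is the indicator function of the
times at which there is room (so that newcomers are admitted). -/
structure IsLossSystem (K : ℝ) (S Φ a q : ℝ → ℝ) : Prop where
  admission_measurable : Measurable a
  survival_antitone : Antitone Φ
  survival_nonneg : ∀ u, 0 ≤ Φ u
  survival_integrable : IntegrableOn Φ (Ioi 0)
  initial_antitone : Antitone S
  initial_tendsto : Tendsto S atTop (𝓝 0)
  initial_leftContinuous : ∀ t, ContinuousWithinAt S (Iic t) t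
  population_eq : ∀ t, 0 ≤ t → q t = S t + conv a Φ t
  admission_of_lt : ∀ t, q t < K → a t = 1
  admission_of_le : ∀ t, K ≤ q t → a t = 0

namespace IsLossSystem

variable {K : ℝ} {S Φ a q : ℝ → ℝ} {t t₀ τ : ℝ}

theorem admission_mem_Icc (h : IsLossSystem K S Φ a q) (t : ℝ) : a t ∈ Icc (0 : ℝ) 1 := by
  rcases lt_or_ge (q t) K with hq | hq
  · rw [h.admission_of_lt t hq]
    exact ⟨zero_le_one, le_rfl⟩
  · rw [h.admission_of_le t hq]
    exact ⟨le_rfl, zero_le_one⟩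

theorem intervalIntegrable_admission (h : IsLossSystem K S Φ a q) (t : ℝ) :
    IntervalIntegrable a volume 0 t :=
  intervalIntegrable_of_mem_Icc h.admission_measurable h.admission_mem_Icc

theorem continuousWithinAt_population (h : IsLossSystem K S Φ a q) (ht : 0 < t) :
    ContinuousWithinAt q (Iic t) t := by
  refine ((h.initial_leftContinuous t).add (continuousWithinAt_conv h.admission_measurable
    h.admission_mem_Icc h.survival_antitone h.survival_nonneg ht)).congr_of_eventuallyEq ?_
    (h.population_eq t ht.le)
  filter_upwards [nhdsWithin_le_nhds (lt_mem_nhds ht)] with s hs using h.population_eq s hs.le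

theorem exists_population_le (h : IsLossSystem K S Φ a q) (hK : 0 < K) :
    ∃ t₀, 0 < t₀ ∧ q t₀ ≤ K := by
  by_contra! hfull
  obtain ⟨t, hSt, ht⟩ :=
    ((h.initial_tendsto.eventually (gt_mem_nhds hK)).and (eventually_gt_atTop 0)).exists
  have hempty : conv a Φ t ≤ conv a Φ 0 := conv_le_of_off h.admission_measurable
    h.admission_mem_Icc h.survival_antitone le_rfl ht.le
    fun s hs => h.admission_of_le s (hfull s hs.1).le
  have hzero : conv a Φ 0 = 0 := intervalIntegral.integral_same
  linarith [h.population_eq t ht.le, hfull t ht]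

theorem population_le (h : IsLossSystem K S Φ a q) (ht₀ : 0 < t₀) (hq : q t₀ ≤ K) (ht : t₀ ≤ t) :
    q t ≤ K := by
  obtain ⟨σ, hσ, hσK, hfull⟩ := exists_last_le ht
    (fun s hs => h.continuousWithinAt_population (ht₀.trans_le hs.1)) hq
  have hσ0 : 0 < σ := ht₀.trans_le hσ.1
  have hconv := conv_le_of_off h.admission_measurable h.admission_mem_Icc h.survival_antitone
    hσ0.le hσ.2 fun s hs => h.admission_of_le s (hfull s hs).le
  calc q t = S t + conv a Φ t := h.population_eq t (hσ0.le.trans hσ.2)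
    _ ≤ S σ + conv a Φ σ := add_le_add (h.initial_antitone hσ.2) hconv
    _ = q σ := (h.population_eq σ hσ0.le).symm
    _ ≤ K := hσK

theorem eventually_conv_le (h : IsLossSystem K S Φ a q) (hK : 0 < K) :
    ∀ᶠ t in atTop, conv a Φ t ≤ K := by
  obtain ⟨t₀, ht₀, hq⟩ := h.exists_population_le hK
  filter_upwards [eventually_ge_atTop t₀] with t ht
  linarith [h.population_eq t (ht₀.le.trans ht), h.population_le ht₀ hq ht,
    h.initial_antitone.le_of_tendsto h.initial_tendsto t]

theorem sub_initial_le_conv (h : IsLossSystem K S Φ a q) (hτ : 0 < τ) (hq : K ≤ q τ)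
    (ht : τ ≤ t) : K - S τ ≤ conv a Φ t := by
  obtain ⟨σ, hσ, hσK, hroom⟩ := exists_last_le (f := fun s => -q s) (K := -K) ht
    (fun s hs => (h.continuousWithinAt_population (hτ.trans_le hs.1)).neg) (neg_le_neg hq)
  have hσ0 : 0 < σ := hτ.trans_le hσ.1
  have hconv := conv_le_of_on h.admission_measurable h.admission_mem_Icc h.survival_antitone
    h.survival_nonneg hσ0.le hσ.2 fun s hs => h.admission_of_lt s (neg_lt_neg_iff.1 (hroom s hs))
  linarith [h.population_eq σ hσ0.le, h.initial_antitone hσ.1]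

theorem tendsto_conv (h : IsLossSystem K S Φ a q) (hK : 0 < K) (hfull : ∃ᶠ t in atTop, K ≤ q t) :
    Tendsto (conv a Φ) atTop (𝓝 K) := by
  refine tendsto_order.2 ⟨fun b hb => ?_,
    fun b hb => (h.eventually_conv_le hK).mono fun t ht => ht.trans_lt hb⟩
  obtain ⟨τ, hq, hτ, hSτ⟩ := (hfull.and_eventually ((eventually_gt_atTop 0).and
    (h.initial_tendsto.eventually (gt_mem_nhds (sub_pos.2 hb))))).exists
  filter_upwards [eventually_ge_atTop τ] with t ht
  linarith [h.sub_initial_le_conv hτ hq ht]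

theorem integral_survival_le (h : IsLossSystem K S Φ a q) (hK : 0 < K)
    (hroom : ∀ᶠ t in atTop, q t < K) : ∫ u in Ioi 0, Φ u ≤ K := by
  obtain ⟨τ, hτ⟩ := eventually_atTop.1 (hroom.and (eventually_ge_atTop 0))
  have hlim : Tendsto (fun t => ∫ u in 0..(t - τ), Φ u) atTop (𝓝 (∫ u in Ioi 0, Φ u)) :=
    intervalIntegral_tendsto_integral_Ioi 0 h.survival_integrable
      (tendsto_atTop_add_const_right _ _ tendsto_id)
  refine le_of_tendsto hlim ?_
  filter_upwards [eventually_ge_atTop τ, h.eventually_conv_le hK] with t ht hconv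
  exact (integral_le_conv_of_on h.admission_measurable h.admission_mem_Icc h.survival_antitone
    h.survival_nonneg (hτ τ le_rfl).2 ht
    fun s hs => h.admission_of_lt s (hτ s hs.1.le).1).trans hconv

theorem average_admission_le_one (h : IsLossSystem K S Φ a q) (ht : 0 < t) :
    (∫ s in 0..t, a s) / t ≤ 1 := by
  rw [div_le_one ht]
  simpa using intervalIntegral.integral_mono_on (g := fun _ => (1 : ℝ)) ht.le
    (h.intervalIntegrable_admission t) intervalIntegrable_const fun s _ =>
      (h.admission_mem_Icc s).2

theorem tendsto_average_admission_of_full (h : IsLossSystem K S Φ a q) (hK : 0 < K)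
    (hρ : 0 < ∫ u in Ioi 0, Φ u) (hfull : ∃ᶠ t in atTop, K ≤ q t) :
    Tendsto (fun t => (∫ s in 0..t, a s) / t) atTop (𝓝 (K / ∫ u in Ioi 0, Φ u)) := by
  have havg := tendsto_average (fun t ht => intervalIntegrable_conv ht
    (h.intervalIntegrable_admission t) h.survival_integrable) (h.tendsto_conv hK hfull)
  have hsub := tendsto_average_conv_sub h.admission_measurable h.admission_mem_Icc
    h.survival_integrable h.survival_nonneg
  simpa only [sub_sub_cancel, sub_zero, mul_div_cancel_right₀ _ hρ.ne'] using
    (havg.sub hsub).div_const (∫ u in Ioi 0, Φ u)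

theorem tendsto_average_admission (h : IsLossSystem K S Φ a q) (hK : 0 < K)
    (hρ : 0 < ∫ u in Ioi 0, Φ u) :
    Tendsto (fun t => (∫ s in 0..t, a s) / t) atTop (𝓝 (min 1 (K / ∫ u in Ioi 0, Φ u))) := by
  by_cases hfull : ∃ᶠ t in atTop, K ≤ q t
  · have hlim := h.tendsto_average_admission_of_full hK hρ hfull
    have hle : K / ∫ u in Ioi 0, Φ u ≤ 1 := le_of_tendsto hlim <|
      (eventually_gt_atTop 0).mono fun t ht => h.average_admission_le_one ht
    rwa [min_eq_right hle]
  · have hroom : ∀ᶠ t in atTop, q t < K := by simpa only [not_frequently, not_le] using hfull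
    rw [min_eq_left ((one_le_div hρ).2 (h.integral_survival_le hK hroom))]
    exact tendsto_average (fun t _ => h.intervalIntegrable_admission t)
      (tendsto_const_nhds.congr' (hroom.mono fun t ht => (h.admission_of_lt t ht).symm))

end IsLossSystem

theorem eq_mul_integral_of_tendsto_conv {a h : ℝ → ℝ} {α β : ℝ} (ha : Measurable a)
    (ha1 : ∀ s, a s ∈ Icc (0 : ℝ) 1) (hh : IntegrableOn h (Ioi 0)) (h0 : ∀ u, 0 ≤ h u)
    (hα : Tendsto (fun t => (∫ s in 0..t, a s) / t) atTop (𝓝 α))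
    (hβ : Tendsto (conv a h) atTop (𝓝 β)) : β = α * ∫ u in Ioi 0, h u := by
  have havg := tendsto_average
    (fun t ht => intervalIntegrable_conv ht (intervalIntegrable_of_mem_Icc ha ha1) hh) hβ
  exact sub_eq_zero.1 (tendsto_nhds_unique (havg.sub (hα.mul_const _))
    (tendsto_average_conv_sub ha ha1 hh h0))

section Survival

variable {Ω : Type*} [MeasurableSpace Ω] {μ : Measure Ω} {X : Ω → ℝ}

/-- The survival function of the random variable `X`, with a non-strict inequality (so that it is
left-continuous), as in the fluid equations. -/
def survival (μ : Measure Ω) (X : Ω → ℝ) (t : ℝ) : ℝ := μ.real {ω | t ≤ X ω}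

theorem survival_nonneg (t : ℝ) : 0 ≤ survival μ X t := measureReal_nonneg

theorem survival_antitone [IsFiniteMeasure μ] : Antitone (survival μ X) :=
  fun _ _ hst => measureReal_mono fun _ hω => hst.trans hω

theorem survival_eq_cdf [IsProbabilityMeasure μ] (hX : Measurable X) (t : ℝ) :
    survival μ X t = ProbabilityTheory.cdf (μ.map fun ω => -X ω) (-t) := by
  have hneg : Measurable fun ω => -X ω := hX.neg
  have := Measure.isProbabilityMeasure_map (μ := μ) hneg.aemeasurable
  rw [ProbabilityTheory.cdf_eq_real, map_measureReal_apply hneg measurableSet_Iic]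
  simp only [survival, preimage_ofPred_eq, Iic, neg_le_neg_iff]

theorem tendsto_survival_atTop [IsProbabilityMeasure μ] (hX : Measurable X) :
    Tendsto (survival μ X) atTop (𝓝 0) := by
  simp only [funext (survival_eq_cdf (μ := μ) hX)]
  exact (ProbabilityTheory.tendsto_cdf_atBot _).comp tendsto_neg_atTop_atBot

theorem continuousWithinAt_survival [IsProbabilityMeasure μ] (hX : Measurable X) (t : ℝ) :
    ContinuousWithinAt (survival μ X) (Iic t) t := by
  rw [funext (survival_eq_cdf (μ := μ) hX)]
  exact ((ProbabilityTheory.cdf _).right_continuous (-t)).comp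
    continuous_neg.continuousWithinAt fun s hs => mem_Ici.2 (neg_le_neg (mem_Iic.1 hs))

theorem integrableOn_survival (hX : Integrable X μ) (h0 : 0 ≤ᵐ[μ] X) :
    IntegrableOn (survival μ X) (Ioi 0) := by
  have hanti : Antitone fun t => μ {ω | t ≤ X ω} :=
    fun _ _ hst => measure_mono fun _ hω => hst.trans hω
  refine integrable_toReal_of_lintegral_ne_top hanti.measurable.aemeasurable ?_
  rw [← lintegral_eq_lintegral_meas_le μ h0 hX.aemeasurable]
  exact hX.lintegral_lt_top.ne

theorem integral_survival (hX : Integrable X μ) (h0 : 0 ≤ᵐ[μ] X) :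
    ∫ t in Ioi 0, survival μ X t = ∫ ω, X ω ∂μ :=
  (hX.integral_eq_integral_meas_le h0).symm

end Survival

namespace Network

section ChargingSurvival

variable {b d p t : ℝ} {μ : Measure (ℝ × ℝ)}

theorem le_sojourn (hp : 0 ≤ p) (hb : t * p ≤ b) (hd : t ≤ d) : t ≤ sojourn b d p := by
  unfold sojourn
  split_ifs with hp0
  · exact hd
  · exact le_min hd ((le_div_iff₀ (hp.lt_of_ne' hp0)).2 hb)

theorem mul_lt_of_lt_sojourn (hp : 0 ≤ p) (hb : 0 < b) (ht : t < sojourn b d p) : t * p < b := by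
  rcases hp.eq_or_lt with rfl | hp
  · rwa [mul_zero]
  · rw [sojourn_of_pos hp] at ht
    exact (lt_div_iff₀ hp).1 (ht.trans_le (min_le_right _ _))

/-- The probability that an EV that is charged at the constant rate `p` is still being charged a
time `t` after its arrival; `μ` is the joint law of its charging requirement and parking time. -/
def chargingSurvival (μ : Measure (ℝ × ℝ)) (p t : ℝ) : ℝ := μ.real {x | t * p < x.1 ∧ t ≤ x.2}

theorem chargingSurvival_nonneg (t : ℝ) : 0 ≤ chargingSurvival μ p t := measureReal_nonneg

theorem tendsto_chargingSurvival [IsProbabilityMeasure μ] :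
    Tendsto (chargingSurvival μ p) atTop (𝓝 0) :=
  squeeze_zero chargingSurvival_nonneg (fun _ => measureReal_mono fun _ hx => hx.2)
    (tendsto_survival_atTop measurable_snd)

-- The charging time `T` satisfies `{t < T} ⊆ {t * p < B, t ≤ D} ⊆ {t ≤ T}`, and the outer two
-- events have the same probability for all but countably many `t`.
theorem chargingSurvival_ae_eq [IsFiniteMeasure μ] (hB : ∀ᵐ x ∂μ, 0 < x.1) (hp : 0 ≤ p) :
    chargingSurvival μ p =ᵐ[volume] survival μ fun x => sojourn x.1 x.2 p := by
  filter_upwards [meas_le_ae_eq_meas_lt μ volume fun x : ℝ × ℝ => sojourn x.1 x.2 p] with t ht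
  refine congrArg ENNReal.toReal (le_antisymm (measure_mono fun x hx => ?_) ?_)
  · exact le_sojourn hp hx.1.le hx.2
  · rw [ht]
    refine measure_mono_ae ?_
    filter_upwards [hB] with x hx hxt
    exact ⟨mul_lt_of_lt_sojourn hp hx hxt, le_of_lt (lt_of_lt_of_le hxt sojourn_le)⟩

variable [IsFiniteMeasure μ] (hB : ∀ᵐ x ∂μ, 0 < x.1) (hD : ∀ᵐ x ∂μ, 0 < x.2)
  (hDi : Integrable (fun x => x.2) μ) (hp : 0 ≤ p)

include hB hD hDi hp

theorem integrableOn_chargingSurvival : IntegrableOn (chargingSurvival μ p) (Ioi 0) :=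
  (integrableOn_survival (integrable_sojourn hB hD hDi hp)
    (by filter_upwards [hB, hD] with x hxB hxD using (sojourn_pos hxB hxD hp).le)).congr
    (ae_restrict_of_ae (chargingSurvival_ae_eq hB hp).symm)

theorem integral_chargingSurvival :
    ∫ t in Ioi 0, chargingSurvival μ p t = ∫ x, sojourn x.1 x.2 p ∂μ := by
  rw [integral_congr_ae (ae_restrict_of_ae (chargingSurvival_ae_eq hB hp))]
  exact integral_survival (integrable_sojourn hB hD hDi hp)
    (by filter_upwards [hB, hD] with x hxB hxD using (sojourn_pos hxB hxD hp).le)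

end ChargingSurvival

variable {N T : Type*} [Fintype N] [Fintype T] {𝒩 : Network N T} {F₀ : N → T → Measure (ℝ × ℝ)}
  {q : ℝ → N → T → ℝ} {z : N → T → ℝ}

/-- The indicator function of the times at which there is a free parking space at node `i`. -/
def room (𝒩 : Network N T) (q : ℝ → N → T → ℝ) (i : N) : ℝ → ℝ :=
  {t | total q i t < 𝒩.K i}.indicator 1

omit [Fintype N] in
theorem integral_admission_mul (h : ℝ → ℝ) (i : N) (j : T) (t : ℝ) :
    ∫ s in 0..t, 𝒩.admission q i j s * h (t - s) = 𝒩.lam i j * conv (𝒩.room q i) h t := by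
  classical
  rw [conv, ← intervalIntegral.integral_const_mul]
  refine intervalIntegral.integral_congr fun s _ => ?_
  simp only [admission, room, indicator_apply, mem_ofPred_eq, Pi.one_apply]
  split_ifs <;> ring

namespace IsFluidSolution

theorem measurable_room {z : ℝ → N → T → ℝ} (hsol : 𝒩.IsFluidSolution F₀ q z) (i : N) :
    Measurable (𝒩.room q i) :=
  measurable_one.indicator (measurableSet_lt
    (Finset.measurable_fun_sum _ fun j _ => hsol.q_measurable i j) measurable_const)

theorem isLossSystem [∀ i j, IsProbabilityMeasure (F₀ i j)] {z : ℝ → N → T → ℝ}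
    (hsol : 𝒩.IsFluidSolution F₀ q z) (h : 𝒩.Standing) (i : N) :
    IsLossSystem (𝒩.K i) (fun t => ∑ j, q 0 i j * survival (F₀ i j) Prod.snd t)
      (fun u => ∑ j, 𝒩.lam i j * survival (𝒩.F j) Prod.snd u) (𝒩.room q i) (total q i) where
  admission_measurable := hsol.measurable_room i
  survival_antitone := fun s t hst => by
    have := h.prob
    exact Finset.sum_le_sum fun j _ =>
      mul_le_mul_of_nonneg_left (survival_antitone hst) (h.lam_pos i j).le
  survival_nonneg := fun u =>
    Finset.sum_nonneg fun j _ => mul_nonneg (h.lam_pos i j).le (survival_nonneg u)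
  survival_integrable := integrable_finsetSum _ fun j _ =>
    (integrableOn_survival (h.D_integrable j) ((h.D_pos j).mono fun _ => le_of_lt)).const_mul _
  initial_antitone := fun s t hst => Finset.sum_le_sum fun j _ =>
    mul_le_mul_of_nonneg_left (survival_antitone hst) (hsol.q_init i j)
  initial_tendsto := by
    simpa only [mul_zero, Finset.sum_const_zero] using tendsto_finsetSum Finset.univ fun j _ =>
      (tendsto_survival_atTop (μ := F₀ i j) measurable_snd).const_mul (q 0 i j)
  initial_leftContinuous := fun t =>
    tendsto_finsetSum _ fun j _ => (continuousWithinAt_survival measurable_snd t).const_mul _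
  population_eq := fun t ht => by
    have := h.prob
    have hroom (s : ℝ) : 𝒩.room q i s ∈ Icc (0 : ℝ) 1 := by
      rw [room, indicator_apply]
      split_ifs <;> simp
    rw [conv_sum_const_mul _ _ fun j _ => intervalIntegrable_mul_comp_sub (hsol.measurable_room i)
      hroom survival_antitone.intervalIntegrable, ← Finset.sum_add_distrib, total]
    refine Finset.sum_congr rfl fun j _ => (hsol.q_eq t ht i j).trans ?_
    exact congrArg _ (integral_admission_mul (survival (𝒩.F j) Prod.snd) i j t)
  admission_of_lt := fun _ ht => indicator_of_mem (mem_ofPred_eq ▸ ht) _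
  admission_of_le := fun t ht =>
    indicator_of_notMem (s := {t | total q i t < 𝒩.K i}) (a := t) (not_lt.2 ht) _

theorem tendsto_average_room [Nonempty T] [∀ i j, IsProbabilityMeasure (F₀ i j)]
    {z : ℝ → N → T → ℝ} (hsol : 𝒩.IsFluidSolution F₀ q z) (h : 𝒩.Standing) (i : N) :
    Tendsto (fun t => (∫ s in 0..t, 𝒩.room q i s) / t) atTop
      (𝓝 (min 1 (𝒩.K i / ∑ j, 𝒩.lam i j * 𝒩.meanD j))) := by
  have hD0 (j : T) : 0 ≤ᵐ[𝒩.F j] Prod.snd := (h.D_pos j).mono fun _ => le_of_lt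
  have hρ : ∫ u in Ioi 0, ∑ j, 𝒩.lam i j * survival (𝒩.F j) Prod.snd u
      = ∑ j, 𝒩.lam i j * 𝒩.meanD j := by
    rw [integral_finsetSum _ fun j _ =>
      (integrableOn_survival (h.D_integrable j) (hD0 j)).const_mul _]
    exact Finset.sum_congr rfl fun j _ => by
      rw [integral_const_mul, integral_survival (h.D_integrable j) (hD0 j), meanD]
  rw [← hρ]
  exact (hsol.isLossSystem h i).tendsto_average_admission (h.K_pos i)
    (hρ ▸ h.sum_lam_mul_meanD_pos i)

theorem eq_add_conv (hsol : 𝒩.IsFluidSolution F₀ q fun _ => z) (i : N) (j : T) {t : ℝ}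
    (ht : 0 ≤ t) :
    z i j = z i j * chargingSurvival (F₀ i j) (𝒩.rate z i j) t
      + 𝒩.lam i j * conv (𝒩.room q i) (chargingSurvival (𝒩.F j) (𝒩.rate z i j)) t := by
  have hz := hsol.z_eq t ht i j
  simp only [intervalIntegral.integral_const, smul_eq_mul, sub_zero] at hz
  exact hz.trans (congrArg _
    (integral_admission_mul (chargingSurvival (𝒩.F j) (𝒩.rate z i j)) i j t))

theorem tendsto_conv_chargingSurvival [∀ i j, IsProbabilityMeasure (F₀ i j)]
    (hsol : 𝒩.IsFluidSolution F₀ q fun _ => z) (i : N) (j : T) (hlam : 0 < 𝒩.lam i j) :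
    Tendsto (conv (𝒩.room q i) (chargingSurvival (𝒩.F j) (𝒩.rate z i j))) atTop
      (𝓝 (z i j / 𝒩.lam i j)) := by
  have hlim : Tendsto (fun t => (z i j - z i j * chargingSurvival (F₀ i j) (𝒩.rate z i j) t)
      / 𝒩.lam i j) atTop (𝓝 (z i j / 𝒩.lam i j)) := by
    simpa only [mul_zero, sub_zero] using
      ((tendsto_chargingSurvival.const_mul (z i j)).const_sub (z i j)).div_const (𝒩.lam i j)
  refine hlim.congr' ?_
  filter_upwards [eventually_ge_atTop 0] with t ht
  rw [div_eq_iff hlam.ne']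
  linarith [hsol.eq_add_conv i j ht]

end IsFluidSolution

theorem IsInvariantPoint.isFixedPoint (hz : 𝒩.IsInvariantPoint z) (h : 𝒩.Standing) :
    𝒩.IsFixedPoint z := by
  obtain ⟨F₀, q, hF₀, hsol⟩ := hz
  have hz0 : ∀ i j, 0 ≤ z i j := hsol.nonneg 0 le_rfl
  refine ⟨hz0, fun i j => ?_⟩
  have hprob := h.prob
  have : Nonempty T := ⟨j⟩
  have hp := (h.isChargingRate_rate hz0).feasible.nonneg i j
  have hbalance := eq_mul_integral_of_tendsto_conv (hsol.measurable_room i)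
    (hsol.isLossSystem h i).admission_mem_Icc
    (integrableOn_chargingSurvival (h.B_pos j) (h.D_pos j) (h.D_integrable j) hp)
    chargingSurvival_nonneg (hsol.tendsto_average_room h i)
    (hsol.tendsto_conv_chargingSurvival i j (h.lam_pos i j))
  rw [integral_chargingSurvival (h.B_pos j) (h.D_pos j) (h.D_integrable j) hp,
    div_eq_iff (h.lam_pos i j).ne'] at hbalance
  rw [hbalance, h.gam_eq_lam_mul_min i j]
  ring

end Network

end EVCharging

end

theorem theorem1 {N T : Type*} [Fintype N] [Fintype T]
    (𝒩 : EVCharging.Network N T) (h𝒩 : 𝒩.Standing) :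
    (∀ z : N → T → ℝ, 𝒩.IsInvariantPoint z → 𝒩.IsFixedPoint z) ∧
    ((∀ j, EVCharging.leftmost ((𝒩.F j).map (fun x => x.2 / x.1)) ≤ 1 / 𝒩.cmax j) →
      (∃ G : N → T → ℝ → EReal, ∀ i j, 𝒩.IsPrimitive i j (G i j)) ∧
      ∀ G : N → T → ℝ → EReal, (∀ i j, 𝒩.IsPrimitive i j (G i j)) →
        (∀ i j, EVCharging.StrictConcaveOnE (Set.Icc 0 (𝒩.g i j (𝒩.cmax j))) (G i j)) ∧
        (∃! Λ : N → T → ℝ, 𝒩.IsOPFSolution G Λ) ∧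
        (∃! z : N → T → ℝ, 𝒩.IsFixedPoint z) ∧
        ∀ z Λ : N → T → ℝ, 𝒩.IsFixedPoint z → 𝒩.IsOPFSolution G Λ →
          ∀ i j, z i j = Λ i j / 𝒩.gInv i j (Λ i j)) := by
  refine ⟨fun z hz => hz.isFixedPoint h𝒩, fun hs => ⟨?_, fun G hG => ⟨fun i j => ?_, ?_, ?_, ?_⟩⟩⟩
  · choose G hG using fun i j => h𝒩.exists_isPrimitive (hs j) i
    exact ⟨G, hG⟩
  · exact ((hG i j).isMarginal h𝒩 (hs j)).strictConcaveOnE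
  · exact h𝒩.existsUnique_isOPFSolution hs hG
  · exact h𝒩.existsUnique_isFixedPoint hs hG
  · exact fun z Λ hz hΛ => hz.eq_div_gInv h𝒩 hs hG hΛ
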